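/- **Conventions.** Let $p$ be a prime. A *partial group* is a non-empty set $\mathcal L$ with a set $\mathbf D$ of words in $\mathcal L$, a product $\Pi:\mathbf D\to\mathcal L$ and an involutory inversion (extended to words by $(g_1,\dots,g_k)^{-1}=(g_k^{-1},\dots,g_1^{-1})$) such that: $\mathbf D$ contains all words of length $1$, on which $\Pi$ is the identity; $u\circ v\in\mathbf D$ implies $u,v\in\mathbf D$; $u\circ v\circ w\in\mathbf D$ implies $u\circ(\Pi(v))\circ w\in\mathbf D$ and $\Pi(u\circ v\circ w)=\Pi(u\circ(\Pi(v))\circ w)$; and $w\in\mathbf D$ implies $w^{-1}\circ w\in\mathbf D$ and $\Pi(w^{-1}\circ w)=\mathbf 1:=\Pi(\emptyset)$. Write $x^g=\Pi(g^{-1},x,g)$ when $(g^{-1},x,g)\in\mathbf D$; a statement about $x^g$, or $H^g=\{h^g: h\in H\}$, includes that it is defined. Put $N_{\mathcal L}(H)=\{g: H^g=H\}$, $C_{\mathcal L}(H)=\{g: h^g=h\text{ for all }h\in H\}$ and $C_{\mathcal L}(h)=C_{\mathcal L}(\{h\})$. A *partial subgroup* is a non-empty subset closed under inversion and under products of its words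 lying in $\mathbf D$; it is a *subgroup* (and then a group) if all its words lie in $\mathbf D$; it is *partial normal* if it contains $n^g$ for each of its elements $n$ and each $g\in\mathcal L$ for which $n^g$ is defined. A *$p'$-subgroup* is a subgroup of order prime to $p$. A *locality* $(\mathcal L,\Delta,S)$ consists of a finite partial group $\mathcal L$, a maximal $p$-subgroup $S$ of $\mathcal L$ and a non-empty set $\Delta$ of subgroups of $S$, closed under overgroups in $S$ and under those conjugates $P^g$ ($P\in\Delta$, $g\in\mathcal L$) that are defined and contained in $S$, such that $(f_1,\dots,f_n)\in\mathbf D$ if and only if there are $P_0,\dots,P_n\in\Delta$ with $P_{i-1}^{f_i}=P_i$ for all $i$. Its fusion system $\mathcal F_S(\mathcal L)$ is the fusion system over $S$ generated by the maps $P\to P^g$, $x\mapsto x^g$, with $P\in\Delta$, $g\in\mathcal L$ and $P^g\le S$. It is a *punctured group* if $\Delta$ is the set of all non-identity subgroups of $S$. For a partial normal subgroup $\mathcal N$, $\mathcal L/\mathcal N$ is the set of inclusion-maximal cosets $\mathcal Nf=\{\Pi(n,f): n\in\mathcal N,\ (n,f)\in\mathbf D\}$. Let $\mathcal I_p(P)$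 be the set of elements of order $p$ of $P$. A *signalizer functor of $(\mathcal L,\Delta,S)$ on elements of order $p$* assigns to each $a\in\mathcal I_p(S)$ a normal $p'$-subgroup $\theta(a)$ of $C_{\mathcal L}(a)$ such that $\theta(a^g)=\theta(a)^g$ whenever $g\in\mathcal L$ and $a^g$ is defined and lies in $S$, and $\theta(a)\cap C_{\mathcal L}(b)\le\theta(b)$ for all $a,b\in\mathcal I_p(S)$ with $[a,b]=1$. A *signalizer functor on objects* assigns to each $P\in\Delta$ a normal $p'$-subgroup $\Theta(P)$ of $N_{\mathcal L}(P)$ such that $\Theta(P)^g=\Theta(P^g)$ for all $P\in\Delta$ and $g\in\mathcal L$ with $P^g$ defined and contained in $S$, and $\Theta(P)\cap C_{\mathcal L}(Q)=\Theta(Q)$ for all $P\le Q$ in $\Delta$. **Theorem.** Let $(\mathcal L,\Delta,S)$ be a punctured group and let $\theta$ be a signalizer functor of $(\mathcal L,\Delta,S)$ on elements of order $p$. Then $$\Theta(P):=\Big(\bigcap_{x\in\mathcal I_p(P)}\theta(x)\Big)\cap C_{\mathcal L}(P)\qquad(P\in\Delta)$$ defines a signalizer functor on objects, and $$\widehat\Theta:=\bigcup_{x\in\mathcal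 I_p(S)}\theta(x)=\bigcup_{P\in\Delta}\Theta(P)$$ is a partial normal subgroup of $\mathcal L$ with $\widehat\Theta\cap S=\{\mathbf 1\}$. The maximal cosets of $\widehat\Theta$ partition $\mathcal L$, and $\mathcal L/\widehat\Theta$ carries the structure of a partial group for which the natural map $\rho:\mathcal L\to\mathcal L/\widehat\Theta$ (sending $g$ to the maximal coset containing $g$) is a projection, i.e. $\rho$ is a homomorphism of partial groups and maps $\mathbf D$ onto the domain of the product of $\mathcal L/\widehat\Theta$. The map $\rho$ restricts to a group isomorphism $S\to S^\rho$. Upon identifying $S$ with $S^\rho$ along it (and so $\Delta$ with $\{P^\rho: P\in\Delta\}$), the following hold. (a) $(\mathcal L/\widehat\Theta,\Delta,S)$ is a locality, and $\mathcal F_S(\mathcal L/\widehat\Theta)=\mathcal F_S(\mathcal L)$. (b) For each $P\in\Delta$, $\rho$ restricts to an epimorphism of groups $N_{\mathcal L}(P)\to N_{\mathcal L/\widehat\Theta}(P)$ with kernel $\Theta(P)$, and thus induces an isomorphism $N_{\mathcal L}(P)/\Theta(P)\cong N_{\mathcal L/\widehat\Theta}(P)$. -/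

import Mathlib

/-- A partial group. `D` is the set of words on which the product is defined and `prod` is the
product `Π : D → L`. For convenience `prod` is a total function on words; its values outside `D`
carry no information and no axiom below speaks about them. -/
class PartialGroup (L : Type*) extends Inv L where
  nonempty : Nonempty L
  D : Set (List L)
  prod : List L → L
  inv_inv : ∀ g : L, (g⁻¹)⁻¹ = g
  singleton_mem : ∀ g : L, [g] ∈ D
  append_mem : ∀ u v : List L, u ++ v ∈ D → u ∈ D ∧ v ∈ D
  prod_singleton : ∀ g : L, prod [g] = g
  contract_mem : ∀ u v w : List L, u ++ v ++ w ∈ D → u ++ [prod v] ++ w ∈ D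
  prod_contract : ∀ u v w : List L, u ++ v ++ w ∈ D →
    prod (u ++ v ++ w) = prod (u ++ [prod v] ++ w)
  inv_append_mem : ∀ w : List L, w ∈ D → (w.map (·⁻¹)).reverse ++ w ∈ D
  prod_inv_append : ∀ w : List L, w ∈ D → prod ((w.map (·⁻¹)).reverse ++ w) = prod []

namespace PartialGroup

section Basic

variable {L : Type*} [PartialGroup L]

variable (L) in
/-- The identity element `𝟏 = Π(∅)`. -/
def one : L := prod ([] : List L)

/-- `D(g)`, the set of `x` for which the conjugate `x ^ g` is defined. -/
def conjDom (g : L) : Set L := {x | [g⁻¹, x, g] ∈ (D : Set (List L))}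

/-- The conjugate `x ^ g = Π(g⁻¹, x, g)`; meaningful for `x ∈ conjDom g`. -/
def conj (g x : L) : L := prod [g⁻¹, x, g]

/-- `H ^ g` is defined and is equal to `K`. -/
def ConjTo (H : Set L) (g : L) (K : Set L) : Prop := H ⊆ conjDom g ∧ conj g '' H = K

/-- The normalizer `N_L(H)`. -/
def normalizer (H : Set L) : Set L := {g | ConjTo H g H}

/-- The centralizer `C_L(H)`. -/
def centralizer (H : Set L) : Set L := {g | ∀ h ∈ H, h ∈ conjDom g ∧ conj g h = h}

/-- Partial subgroups. -/
structure IsPartialSubgroup (H : Set L) : Prop where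
  nonempty : H.Nonempty
  inv_mem : ∀ g ∈ H, g⁻¹ ∈ H
  prod_mem : ∀ w : List L, w ∈ (D : Set (List L)) → (∀ g ∈ w, g ∈ H) → prod w ∈ H

/-- Subgroups of a partial group: partial subgroups all of whose words lie in `D`. -/
structure IsSubgroup (H : Set L) : Prop extends IsPartialSubgroup H where
  word_mem : ∀ w : List L, (∀ g ∈ w, g ∈ H) → w ∈ (D : Set (List L))

/-- Partial normal subgroups. -/
structure IsPartialNormal (N : Set L) : Prop extends IsPartialSubgroup N where
  conj_mem : ∀ g : L, ∀ n ∈ N, n ∈ conjDom g → conj g n ∈ N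

variable (L) in
/-- A (bundled) subgroup of the partial group `L`. -/
structure Subgrp where
  carrier : Set L
  isSubgroup : IsSubgroup carrier

instance : SetLike (Subgrp L) L where
  coe := Subgrp.carrier
  coe_injective := by
    rintro ⟨A, hA⟩ ⟨B, hB⟩ h
    cases h
    rfl

theorem nil_mem : ([] : List L) ∈ (D : Set (List L)) := by
  obtain ⟨g⟩ := PartialGroup.nonempty (L := L)
  exact (append_mem [] [g] (singleton_mem g)).1

theorem Subgrp.pair_mem (H : Subgrp L) {a b : L} (ha : a ∈ H) (hb : b ∈ H) : prod [a, b] ∈ H := by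
  have hw : ∀ g ∈ [a, b], g ∈ H.carrier := by
    intro g hg
    simp only [List.mem_cons, List.not_mem_nil, or_false] at hg
    rcases hg with rfl | rfl
    · exact ha
    · exact hb
  exact H.isSubgroup.prod_mem _ (H.isSubgroup.word_mem _ hw) hw

theorem Subgrp.triple_dom (H : Subgrp L) {a b c : L} (ha : a ∈ H) (hb : b ∈ H) (hc : c ∈ H) :
    [a, b, c] ∈ (D : Set (List L)) := by
  refine H.isSubgroup.word_mem _ ?_
  intro g hg
  simp only [List.mem_cons, List.not_mem_nil, or_false] at hg
  rcases hg with rfl | rfl | rfl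
  · exact ha
  · exact hb
  · exact hc

theorem prod_one_left (a : L) : prod [one L, a] = a := by
  have h := prod_contract [] [] [a] (singleton_mem a)
  simpa [prod_singleton, one] using h.symm

theorem prod_one_right (a : L) : prod [a, one L] = a := by
  have h := prod_contract [a] [] [] (singleton_mem a)
  simpa [prod_singleton, one] using h.symm

theorem prod_inv_left (a : L) : prod [a⁻¹, a] = one L := by
  have h := prod_inv_append [a] (singleton_mem a)
  simpa [one] using h

/-- A subgroup of a partial group is a group, with multiplication `a * b = Π(a, b)`. -/
instance (H : Subgrp L) : Group H :=
  letI : Mul H := ⟨fun a b => ⟨prod [(a : L), (b : L)], H.pair_mem a.2 b.2⟩⟩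
  letI : One H := ⟨⟨one L, H.isSubgroup.prod_mem [] nil_mem (by simp)⟩⟩
  letI : Inv H := ⟨fun a => ⟨(a : L)⁻¹, H.isSubgroup.inv_mem _ a.2⟩⟩
  Group.ofLeftAxioms
    (by
      intro a b c
      apply Subtype.ext
      have h := H.triple_dom a.2 b.2 c.2
      have h1 := prod_contract [] [(a : L), (b : L)] [(c : L)] h
      have h2 := prod_contract [(a : L)] [(b : L), (c : L)] [] h
      change prod [prod [(a : L), (b : L)], (c : L)] = prod [(a : L), prod [(b : L), (c : L)]]
      simpa using h1.symm.trans h2)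
    (by
      intro a
      apply Subtype.ext
      exact prod_one_left (a : L))
    (by
      intro a
      apply Subtype.ext
      exact prod_inv_left (a : L))

/-- If `Π(x, y) = 𝟏` then `x = y⁻¹`. -/
theorem eq_inv_of_prod_eq_one {x y : L} (h : [x, y] ∈ (D : Set (List L)))
    (h1 : prod [x, y] = one L) : x = y⁻¹ := by
  have a1 : [y⁻¹, x⁻¹] ++ [x, y] ∈ (D : Set (List L)) := by
    simpa using inv_append_mem [x, y] h
  have a2 := inv_append_mem [y⁻¹, x⁻¹] (append_mem _ _ a1).1
  simp only [List.map_cons, List.map_nil, PartialGroup.inv_inv, List.reverse_cons,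
    List.reverse_nil, List.nil_append, List.cons_append] at a2
  have a3 : [x, y, y⁻¹] ∈ (D : Set (List L)) := (append_mem [x, y, y⁻¹] [x⁻¹] a2).1
  have b1 := prod_contract [] [x, y] [y⁻¹] a3
  have b2 := prod_contract [x] [y, y⁻¹] [] a3
  have b3 : prod [y, y⁻¹] = one L := by
    have := prod_inv_left (y⁻¹)
    rwa [PartialGroup.inv_inv] at this
  simp only [List.nil_append, List.cons_append, List.append_nil, h1, b3] at b1 b2
  rw [prod_one_left] at b1
  rw [prod_one_right] at b2
  exact b2.symm.trans b1

end Basic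

/-- Homomorphisms of partial groups. -/
structure Hom (L L' : Type*) [PartialGroup L] [PartialGroup L'] where
  toFun : L → L'
  map_dom : ∀ w : List L, w ∈ (D : Set (List L)) → w.map toFun ∈ (D : Set (List L'))
  map_prod : ∀ w : List L, w ∈ (D : Set (List L)) → toFun (prod w) = prod (w.map toFun)

section Morphisms

variable {L L' : Type*} [PartialGroup L] [PartialGroup L']

instance : CoeFun (Hom L L') (fun _ => L → L') := ⟨Hom.toFun⟩

/-- Projections of partial groups: homomorphisms mapping `D` onto the domain of the target. -/
def Hom.IsProjection (ρ : Hom L L') : Prop :=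
  List.map ρ.toFun '' (D : Set (List L)) = (D : Set (List L'))

theorem Hom.map_inv (ρ : Hom L L') (g : L) : ρ g⁻¹ = (ρ g)⁻¹ := by
  have h : [g⁻¹, g] ∈ (D : Set (List L)) := by simpa using inv_append_mem [g] (singleton_mem g)
  refine eq_inv_of_prod_eq_one (by simpa using ρ.map_dom _ h) ?_
  have h1 := ρ.map_prod _ h
  have h2 := ρ.map_prod [] nil_mem
  rw [prod_inv_left] at h1
  simp only [List.map_cons, List.map_nil] at h1 h2
  rw [← h1]
  exact h2

theorem Hom.exists_lift (ρ : Hom L L') (H : Set L) (w : List L') (hw : ∀ g ∈ w, g ∈ ρ.toFun '' H) :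
    ∃ v : List L, (∀ g ∈ v, g ∈ H) ∧ v.map ρ.toFun = w := by
  induction w with
  | nil => exact ⟨[], by simp, rfl⟩
  | cons a w ih =>
    obtain ⟨v, hv, rfl⟩ := ih (fun g hg => hw g (List.mem_cons_of_mem _ hg))
    obtain ⟨b, hb, rfl⟩ := hw a (List.mem_cons_self ..)
    refine ⟨b :: v, ?_, rfl⟩
    intro g hg
    rcases List.mem_cons.1 hg with rfl | hg
    · exact hb
    · exact hv g hg

/-- The image of a subgroup under a homomorphism of partial groups. -/
def Subgrp.map (ρ : Hom L L') (H : Subgrp L) : Subgrp L' where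
  carrier := ρ.toFun '' (H : Set L)
  isSubgroup :=
    { nonempty := H.isSubgroup.nonempty.image _
      inv_mem := by
        rintro _ ⟨g, hg, rfl⟩
        exact ⟨g⁻¹, H.isSubgroup.inv_mem g hg, ρ.map_inv g⟩
      prod_mem := by
        intro w _ hw
        obtain ⟨v, hv, rfl⟩ := ρ.exists_lift _ w hw
        have hvD := H.isSubgroup.word_mem v hv
        exact ⟨prod v, H.isSubgroup.prod_mem v hvD hv, ρ.map_prod v hvD⟩
      word_mem := by
        intro w hw
        obtain ⟨v, hv, rfl⟩ := ρ.exists_lift _ w hw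
        exact ρ.map_dom v (H.isSubgroup.word_mem v hv) }

end Morphisms

section Quotient

variable {L : Type*} [PartialGroup L]

/-- The coset `N f = {Π(n, f) : n ∈ N, (n, f) ∈ D}`. -/
def coset (N : Set L) (f : L) : Set L :=
  {y | ∃ n ∈ N, [n, f] ∈ (D : Set (List L)) ∧ prod [n, f] = y}

/-- The set `L / N` of cosets of `N` that are maximal with respect to inclusion. -/
def MaxCosets (N : Set L) : Type _ :=
  {C : Set L // Maximal (fun X : Set L => ∃ f : L, X = coset N f) C}

/-- `β` is the natural map `L → L / N`: the maximal cosets of `N` partition `L` and `β g` is the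
unique one containing `g`. If moreover `L / N` is a partial group for which `β` is a
projection, then this determines the domain and the product of `L / N`. -/
def IsNaturalMap (N : Set L) (β : L → MaxCosets N) : Prop :=
  ∀ (g : L) (C : MaxCosets N), g ∈ C.1 ↔ C = β g

end Quotient

section Locality

variable {L : Type*} [PartialGroup L]

/-- `S_g = {s ∈ S ∩ D(g) : s ^ g ∈ S}`. -/
def sub (S : Set L) (g : L) : Set L := {s | s ∈ S ∧ s ∈ conjDom g ∧ conj g s ∈ S}

/-- For `w = (f₁, …, fₙ)` and `P₀`: there are `P₁, …, Pₙ ∈ Δ` such that `Pᵢ₋₁ ^ fᵢ` is defined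
and equal to `Pᵢ` for all `i = 1, …, n`. -/
def Via (Δ : Set (Subgrp L)) : Subgrp L → List L → Prop
  | _, [] => True
  | P, f :: w => ∃ Q ∈ Δ, ConjTo (P : Set L) f (Q : Set L) ∧ Via Δ Q w

/-- `(L, Δ, S)` is a locality at the prime `p`. -/
structure IsLocality (p : ℕ) (Δ : Set (Subgrp L)) (S : Subgrp L) : Prop where
  finite : Finite L
  isPGroup : IsPGroup p S
  objects_nonempty : Δ.Nonempty
  objects_le : ∀ P ∈ Δ, (P : Set L) ⊆ S
  maximal : ∀ R : Subgrp L, IsPGroup p R → (S : Set L) ⊆ R → R = S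
  mem_dom_iff : ∀ w : List L, w ∈ (D : Set (List L)) ↔ ∃ P ∈ Δ, Via Δ P w
  overgroup_mem : ∀ P ∈ Δ, ∀ R : Subgrp L, (P : Set L) ⊆ R → (R : Set L) ⊆ S → R ∈ Δ
  conj_mem : ∀ P ∈ Δ, ∀ g : L, (P : Set L) ⊆ sub (S : Set L) g →
    ∃ Q ∈ Δ, ConjTo (P : Set L) g (Q : Set L)

/-- A punctured group: a locality whose objects are all the nonidentity subgroups of `S`. -/
structure IsPuncturedGroup (p : ℕ) (Δ : Set (Subgrp L)) (S : Subgrp L) : Prop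
    extends IsLocality p Δ S where
  mem_objects_iff : ∀ P : Subgrp L, P ∈ Δ ↔ (P : Set L) ⊆ S ∧ (P : Set L) ≠ {one L}

/-- Partial normal `p'`-subgroups of a locality with Sylow group `S`. -/
structure IsPartialNormalPPrime (S : Subgrp L) (N : Set L) : Prop extends IsPartialNormal N where
  inter_eq : N ∩ (S : Set L) = {one L}

end Locality

/-- A fusion system over the group `S`. -/
@[ext]
structure FusionSystem (S : Type*) [Group S] where
  /-- the set of morphisms from `P` to `Q` -/
  Hom : ∀ P Q : Subgroup S, Set (P →* Q)
  injective : ∀ (P Q : Subgroup S) (φ : P →* Q), φ ∈ Hom P Q → Function.Injective φ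
  /-- all maps between subgroups induced by conjugation in `S` are morphisms -/
  conj_mem : ∀ (P Q : Subgroup S) (φ : P →* Q),
    (∃ s : S, ∀ x : P, (φ x : S) = s⁻¹ * (x : S) * s) → φ ∈ Hom P Q
  comp_mem : ∀ (P Q R : Subgroup S) (φ : P →* Q) (ψ : Q →* R),
    φ ∈ Hom P Q → ψ ∈ Hom Q R → ψ.comp φ ∈ Hom P R
  /-- every morphism `φ` is the composite of an isomorphism `ψ : P → φ(P)` of the fusion system
  and an inclusion -/
  iso_mem : ∀ (P Q : Subgroup S) (φ : P →* Q), φ ∈ Hom P Q →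
    ∀ (R : Subgroup S) (ψ : P ≃* R), (∀ x : P, (ψ x : S) = (φ x : S)) →
      ψ.toMonoidHom ∈ Hom P R ∧ ψ.symm.toMonoidHom ∈ Hom R P

/-- The fusion system over `S` generated by a family of injective homomorphisms between
subgroups of `S`: its morphisms lie in all fusion systems containing the family. -/
def FusionSystem.generate {S : Type*} [Group S] (X : ∀ P Q : Subgroup S, Set (P →* Q)) :
    FusionSystem S where
  Hom P Q := {φ | Function.Injective φ ∧
    ∀ F : FusionSystem S, (∀ A B : Subgroup S, X A B ⊆ F.Hom A B) → φ ∈ F.Hom P Q}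
  injective _ _ _ h := h.1
  conj_mem P Q φ h := by
    refine ⟨?_, fun F _ => F.conj_mem P Q φ h⟩
    obtain ⟨s, hs⟩ := h
    intro x y hxy
    have h1 : s⁻¹ * (x : S) * s = s⁻¹ * (y : S) * s := by rw [← hs, ← hs, hxy]
    exact Subtype.ext (mul_left_cancel (mul_right_cancel h1))
  comp_mem P _ R φ ψ h1 h2 :=
    ⟨h2.1.comp h1.1, fun F hF => F.comp_mem P _ R φ ψ (h1.2 F hF) (h2.2 F hF)⟩
  iso_mem P Q φ h R ψ hψ :=
    ⟨⟨ψ.injective, fun F hF => (F.iso_mem P Q φ (h.2 F hF) R ψ hψ).1⟩,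
      ⟨ψ.symm.injective, fun F hF => (F.iso_mem P Q φ (h.2 F hF) R ψ hψ).2⟩⟩

/-- `e : S ≃* S'` identifies the fusion system `F` over `S` with the fusion system `F'` over
`S'`: a homomorphism `φ : P → Q` is a morphism of `F` if and only if `e⁻¹ φ e : e(P) → e(Q)` is a
morphism of `F'`. -/
def FusionSystem.Identifies {S S' : Type*} [Group S] [Group S'] (e : S ≃* S')
    (F : FusionSystem S) (F' : FusionSystem S') : Prop :=
  ∀ (P Q : Subgroup S) (φ : P →* Q), φ ∈ F.Hom P Q ↔
    ((e.subgroupMap Q).toMonoidHom.comp φ).comp (e.subgroupMap P).symm.toMonoidHom ∈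
      F'.Hom (P.map e.toMonoidHom) (Q.map e.toMonoidHom)

section Signalizer

variable {L : Type*} [PartialGroup L]

/-- The fusion system `F_S(L)`, generated by the conjugation maps `c_g : P → P ^ g ≤ S` with
`P ∈ Δ`. -/
def fusionSystem (Δ : Set (Subgrp L)) (S : Subgrp L) : FusionSystem S :=
  FusionSystem.generate fun P _ =>
    {φ | (∃ P' ∈ Δ, (P' : Set L) = (fun s : S => (s : L)) '' (P : Set S)) ∧
      ∃ g : L, ∀ x : P, ((x : S) : L) ∈ conjDom g ∧ ((φ x : S) : L) = conj g ((x : S) : L)}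

/-- `I_p(P)`, the set of elements of order `p` of `P`. -/
def elemsOfOrder (p : ℕ) (P : Subgrp L) : Set L := {a | ∃ h : a ∈ P, orderOf (⟨a, h⟩ : P) = p}

/-- `K` is a normal `p'`-subgroup of the subgroup `H` of `L`. -/
structure IsNormalPPrimeSubgroup (p : ℕ) (K H : Set L) : Prop where
  isSubgroup : IsSubgroup K
  subset : K ⊆ H
  normal : ∀ h ∈ H, ∀ k ∈ K, k ∈ conjDom h → conj h k ∈ K
  not_dvd : ¬ p ∣ Nat.card K

/-- `θ` is a signalizer functor of `(L, Δ, S)` on elements of order `p`. Only the values of `θ`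
on `I_p(S)` are relevant. -/
structure IsSignalizerFunctor (p : ℕ) (S : Subgrp L) (θ : L → Set L) : Prop where
  normal : ∀ a ∈ elemsOfOrder p S, IsNormalPPrimeSubgroup p (θ a) (centralizer {a})
  conjugacy : ∀ a ∈ elemsOfOrder p S, ∀ g : L, a ∈ conjDom g → conj g a ∈ S →
    ConjTo (θ a) g (θ (conj g a))
  balance : ∀ a ∈ elemsOfOrder p S, ∀ b ∈ elemsOfOrder p S,
    prod [a⁻¹, b⁻¹, a, b] = one L → θ a ∩ centralizer {b} ⊆ θ b

/-- `Θ` is a signalizer functor of `(L, Δ, S)` on objects. Only the values of `Θ` on `Δ` are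
relevant. -/
structure IsSignalizerFunctorOnObjects (p : ℕ) (Δ : Set (Subgrp L)) (Θ : Subgrp L → Set L) :
    Prop where
  normal : ∀ P ∈ Δ, IsNormalPPrimeSubgroup p (Θ P) (normalizer (P : Set L))
  conjugacy : ∀ P ∈ Δ, ∀ Q ∈ Δ, ∀ g : L, ConjTo (P : Set L) g (Q : Set L) →
    ConjTo (Θ P) g (Θ Q)
  balance : ∀ P ∈ Δ, ∀ Q ∈ Δ, (P : Set L) ⊆ Q → Θ P ∩ centralizer (Q : Set L) = Θ Q

/-- `Θ(P)`, the intersection of `C_L(P)` with all `θ(x)`, `x ∈ I_p(P)`. -/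
def onObjects (p : ℕ) (θ : L → Set L) (P : Subgrp L) : Set L :=
  (⋂ x ∈ elemsOfOrder p P, θ x) ∩ centralizer (P : Set L)

/-- The union of the `θ(x)`, `x ∈ I_p(S)`. -/
def unionOf (p : ℕ) (S : Subgrp L) (θ : L → Set L) : Set L := ⋃ x ∈ elemsOfOrder p S, θ x

end Signalizer

end PartialGroup

/-!
Write `N` for the union of the groups `θ(a)`, and `S_g` for the subgroup of all `x ∈ S` with
`x ^ g` defined and in `S`. In a punctured group a word lies in the domain of the product if and
only if it moves some element of order `p` of `S` through elements of `S`, so all computations are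
made along such paths (`Takes`, `Path`).

The decisive fact is that an element `n ∈ N` centralizes `S_n`, and that `n ∈ θ(x)` for every `x`
of order `p` in `S_n` (`takes_eq`, `mem_of_takes`): otherwise the normalizer condition in the
`p`-group `S_n` produces a nontrivial commutator lying both in `S` and in one of the `p'`-groups
`θ(x)`. That `Θ` is a signalizer functor on objects and that `N` is partial normal with
`N ∩ S = 1` are consequences.

For the quotient, `g` lies below `f` if `g = n f` with `n ∈ N` centralizing `S_g`, and `S_g ≤ S_f`.
Every element lies below a maximal one. By the splitting lemma (`stab_mul_le`),
`S_{nf} = C_S(n) ∩ S_f` for `f` maximal, `n ∈ N` and `(n, f)` in the domain; it rests on Sylow's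
theorem in `N_L(Q)` for `Q = C_S(n) ∩ S_f` (`exists_stab_mul`). Hence the cosets of the maximal
elements are precisely the maximal cosets, and they partition `L`. Choosing a maximal element in
each of them gives a section of the natural map `ρ`, which carries the partial group structure over
to `L / N`: replacing the letters of a word by the chosen elements keeps the word in the domain
and changes the product by a left factor from `N` only (`exists_prod_eq`).

All further claims follow from `takes_iff_map`: for a maximal element `f`, the relation `s ^ f = t`
between elements of `S` holds in `L` as soon as it holds for the images in `L / N`. So the
conjugation maps between objects, and with them the domains, the fusion systems and the normalizers
of objects, agree in `L` and `L / N`. The image of `S` is a maximal `p`-subgroup since its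
normalizer in `L / N` is the image of `N_L(S)` (`map_eq_of_isPGroup`).
-/

namespace PartialGroup

/-- The product of two elements of a partial group. -/
local notation:70 a:70 " ⋆ " b:71 => PartialGroup.prod [a, b]

/-! ### Words and conjugation in a partial group -/

section Words

variable {L : Type*} [PartialGroup L]

theorem dom_tail {a : L} {w : List L} (h : a :: w ∈ (D : Set (List L))) :
    w ∈ (D : Set (List L)) := (append_mem [a] w h).2

theorem prod_cons {a : L} {w : List L} (h : a :: w ∈ (D : Set (List L))) :
    prod (a :: w) = a ⋆ prod w := by
  simpa using prod_contract [a] w [] (by simpa using h)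

theorem dom_inv {w : List L} (h : w ∈ (D : Set (List L))) :
    (w.map (·⁻¹)).reverse ∈ (D : Set (List L)) :=
  (append_mem _ _ (inv_append_mem w h)).1

theorem dom_inv_cons {a : L} {w : List L} (h : a :: w ∈ (D : Set (List L))) :
    a⁻¹ :: a :: w ∈ (D : Set (List L)) := by
  have h1 := inv_append_mem _ h
  simp only [List.map_cons, List.reverse_cons, List.append_assoc] at h1
  exact (append_mem _ _ h1).2

theorem inv_mul_cancel_left {a b : L} (h : [a, b] ∈ (D : Set (List L))) :
    a⁻¹ ⋆ (a ⋆ b) = b := by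
  have h1 := dom_inv_cons h
  have h2 := prod_contract [a⁻¹] [a, b] [] h1
  have h3 := prod_contract [] [a⁻¹, a] [b] h1
  simp only [List.nil_append, List.cons_append, List.append_nil, prod_inv_left,
    prod_one_left] at h2 h3
  exact h2.symm.trans h3

theorem mul_left_cancel {a b c : L} (h : [a, b] ∈ (D : Set (List L)))
    (h' : [a, c] ∈ (D : Set (List L))) (e : a ⋆ b = a ⋆ c) : b = c := by
  rw [← inv_mul_cancel_left h, e, inv_mul_cancel_left h']

theorem mul_assoc' {a b c : L} (h : [a, b, c] ∈ (D : Set (List L))) :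
    (a ⋆ b) ⋆ c = a ⋆ (b ⋆ c) := by
  have h2 := prod_contract [a] [b, c] [] h
  have h3 := prod_contract [] [a, b] [c] h
  simp only [List.nil_append, List.cons_append, List.append_nil] at h2 h3
  exact h3.symm.trans h2

theorem prod_inv_right (a : L) : a ⋆ a⁻¹ = one L := by
  have := prod_inv_left a⁻¹
  rwa [PartialGroup.inv_inv] at this

theorem mul_inv_rev' {a b : L} (h : [a, b] ∈ (D : Set (List L))) :
    (a ⋆ b)⁻¹ = b⁻¹ ⋆ a⁻¹ := by
  have h1 : [b⁻¹, a⁻¹, a, b] ∈ (D : Set (List L)) := by simpa using inv_append_mem _ h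
  have h2 := contract_mem [b⁻¹, a⁻¹] [a, b] [] h1
  have h3 := contract_mem [] [b⁻¹, a⁻¹] [a ⋆ b] h2
  have h4 := prod_inv_append _ h
  have h5 := prod_contract [b⁻¹, a⁻¹] [a, b] [] h1
  have h6 := prod_contract [] [b⁻¹, a⁻¹] [a ⋆ b] h2
  simp only [List.nil_append, List.cons_append, List.append_nil, List.map_cons, List.map_nil,
    List.reverse_cons, List.reverse_nil] at h2 h3 h4 h5 h6
  exact (eq_inv_of_prod_eq_one h3 (by rw [← h6, ← h5, h4]; rfl)).symm

theorem one_dom_right (a : L) : [a, one L] ∈ (D : Set (List L)) := by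
  have := contract_mem [a] [] [] (singleton_mem a)
  simpa [one] using this

theorem one_mem_conjDom (g : L) : one L ∈ conjDom g := by
  have h : [g⁻¹, g] ∈ (D : Set (List L)) := dom_inv_cons (singleton_mem g)
  exact contract_mem [g⁻¹] [] [g] h

theorem conj_one (g : L) : conj g (one L) = one L := by
  have h : [g⁻¹, g] ∈ (D : Set (List L)) := dom_inv_cons (singleton_mem g)
  have := prod_contract [g⁻¹] [] [g] h
  exact this.symm.trans (prod_inv_left g)

theorem conjDom_dom {g x : L} (h : x ∈ conjDom g) :
    [g, g⁻¹, x, g, g⁻¹] ∈ (D : Set (List L)) := by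
  have h0 : [g⁻¹, x, g] ∈ (D : Set (List L)) := h
  have h2 : [g⁻¹, x, g] ++ [g⁻¹, x⁻¹, g] ∈ (D : Set (List L)) := by
    simpa [PartialGroup.inv_inv] using inv_append_mem _ (dom_inv h0)
  have h3 : [g⁻¹, x, g, g⁻¹] ∈ (D : Set (List L)) := (append_mem [g⁻¹, x, g, g⁻¹] _ h2).1
  simpa [PartialGroup.inv_inv] using dom_inv_cons h3

theorem conj_mem_conjDom_inv {g x : L} (h : x ∈ conjDom g) : conj g x ∈ conjDom g⁻¹ := by
  have := contract_mem [g] [g⁻¹, x, g] [g⁻¹] (conjDom_dom h)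
  simpa [conjDom, conj, PartialGroup.inv_inv] using this

theorem conj_inv_conj {g x : L} (h : x ∈ conjDom g) : conj g⁻¹ (conj g x) = x := by
  have h0 := conjDom_dom h
  have h1 := prod_contract [g] [g⁻¹, x, g] [g⁻¹] h0
  have h2 := prod_contract [] [g, g⁻¹] [x, g, g⁻¹] h0
  have h3 := contract_mem [] [g, g⁻¹] [x, g, g⁻¹] h0
  have h4 := prod_contract [g ⋆ g⁻¹, x] [g, g⁻¹] [] h3
  have h5 := contract_mem [g ⋆ g⁻¹, x] [g, g⁻¹] [] h3
  simp only [List.nil_append, List.cons_append, List.append_nil] at h1 h2 h3 h4 h5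
  simp only [conj, PartialGroup.inv_inv]
  rw [prod_inv_right] at h4 h5
  rw [← h1, h2, prod_inv_right, h4, prod_cons h5, prod_one_right, prod_one_left]

theorem conj_injOn {g x y : L} (hx : x ∈ conjDom g) (hy : y ∈ conjDom g)
    (h : conj g x = conj g y) : x = y := by
  rw [← conj_inv_conj hx, h, conj_inv_conj hy]

theorem ConjTo.inv {H K : Set L} {g : L} (h : ConjTo H g K) : ConjTo K g⁻¹ H := by
  obtain ⟨h1, rfl⟩ := h
  refine ⟨?_, ?_⟩
  · rintro _ ⟨x, hx, rfl⟩
    exact conj_mem_conjDom_inv (h1 hx)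
  · ext y
    constructor
    · rintro ⟨_, ⟨x, hx, rfl⟩, rfl⟩
      rwa [conj_inv_conj (h1 hx)]
    · exact fun hy => ⟨_, ⟨y, hy, rfl⟩, conj_inv_conj (h1 hy)⟩

theorem dom_mul_conj {g x : L} (h : x ∈ conjDom g) : [g, conj g x] ∈ (D : Set (List L)) := by
  exact (append_mem _ _ (contract_mem [g] [g⁻¹, x, g] [g⁻¹] (conjDom_dom h))).1

theorem mul_conj {g x : L} (h : x ∈ conjDom g) : g ⋆ conj g x = x ⋆ g := by
  have h0 : [g, g⁻¹, x, g] ∈ (D : Set (List L)) := (append_mem _ [g⁻¹] (conjDom_dom h)).1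
  have h1 := prod_contract [g] [g⁻¹, x, g] [] h0
  have h2 := prod_contract [] [g, g⁻¹] [x, g] h0
  have h3 := contract_mem [] [g, g⁻¹] [x, g] h0
  have h4 := prod_contract [g ⋆ g⁻¹] [x, g] [] h3
  simp only [List.nil_append, List.cons_append, List.append_nil, prod_inv_right,
    prod_one_left] at h1 h2 h4
  rw [conj, ← h1, h2, h4]

/-- Conversely, `x g = g y` determines the conjugate `x ^ g`. -/
theorem conj_eq_of_mul_eq {g x y : L} (h : x ∈ conjDom g) (hy : [g, y] ∈ (D : Set (List L)))
    (e : x ⋆ g = g ⋆ y) : conj g x = y :=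
  mul_left_cancel (dom_mul_conj h) hy ((mul_conj h).trans e)

theorem conj_inv_arg {g x : L} (h : x ∈ conjDom g) :
    x⁻¹ ∈ conjDom g ∧ conj g x⁻¹ = (conj g x)⁻¹ := by
  have h0 : [g⁻¹, x, g] ∈ (D : Set (List L)) := h
  have h1 : [g⁻¹, x⁻¹, g] ∈ (D : Set (List L)) := by
    simpa [PartialGroup.inv_inv] using dom_inv h0
  refine ⟨h1, ?_⟩
  have h2 : [g⁻¹, x⁻¹, g, g⁻¹, x, g] ∈ (D : Set (List L)) := by
    simpa [PartialGroup.inv_inv] using inv_append_mem _ h0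
  have h3 := contract_mem [] [g⁻¹, x⁻¹, g] _ h2
  have h4 := contract_mem [conj g x⁻¹] [g⁻¹, x, g] [] h3
  have h5 := prod_contract [] [g⁻¹, x⁻¹, g] _ h2
  have h6 := prod_contract [conj g x⁻¹] [g⁻¹, x, g] [] h3
  have h7 := prod_inv_append _ h0
  simp only [List.nil_append, List.cons_append, List.append_nil, List.map_cons, List.map_nil,
    List.reverse_cons, List.reverse_nil, PartialGroup.inv_inv] at h3 h4 h5 h6 h7
  refine eq_inv_of_prod_eq_one h4 ?_
  exact h6.symm.trans (h5.symm.trans h7)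

end Words

/-! ### Subgroups of a partial group -/

namespace Subgrp

variable {L : Type*} [PartialGroup L]

@[simp] theorem coe_mul (H : Subgrp L) (a b : H) : ((a * b : H) : L) = (a : L) ⋆ (b : L) := rfl
@[simp] theorem coe_one (H : Subgrp L) : ((1 : H) : L) = one L := rfl
@[simp] theorem coe_inv (H : Subgrp L) (a : H) : ((a⁻¹ : H) : L) = (a : L)⁻¹ := rfl

theorem one_mem (H : Subgrp L) : one L ∈ H := (1 : H).2

theorem inv_mem (H : Subgrp L) {a : L} (ha : a ∈ H) : a⁻¹ ∈ H := H.isSubgroup.inv_mem a ha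

theorem pair_dom (H : Subgrp L) {a b : L} (ha : a ∈ H) (hb : b ∈ H) :
    [a, b] ∈ (D : Set (List L)) := dom_tail (H.triple_dom ha ha hb)

/-- The inclusion between subgroups of a partial group. -/
def inclusion {H K : Subgrp L} (h : (H : Set L) ⊆ K) : H →* K where
  toFun a := ⟨a, h a.2⟩
  map_one' := rfl
  map_mul' _ _ := rfl

theorem inclusion_injective {H K : Subgrp L} (h : (H : Set L) ⊆ K) :
    Function.Injective (inclusion h) := by
  intro a b e
  have := congrArg (fun z : K => (z : L)) e
  exact Subtype.ext this

theorem coe_pow_eq {H K : Subgrp L} {a : L} (h : a ∈ H) (k : a ∈ K) (n : ℕ) :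
    (((⟨a, h⟩ : H) ^ n : H) : L) = ((⟨a, k⟩ : K) ^ n : K) := by
  induction n with
  | zero => rfl
  | succ n ih => rw [pow_succ, pow_succ, coe_mul, coe_mul, ih]

/-- The order of an element does not depend on the subgroup in which it is computed. -/
theorem orderOf_eq {H K : Subgrp L} {a : L} (h : a ∈ H) (k : a ∈ K) :
    orderOf (⟨a, h⟩ : H) = orderOf (⟨a, k⟩ : K) := by
  refine orderOf_eq_orderOf_iff.2 fun n => ?_
  rw [← Subtype.coe_inj, ← Subtype.coe_inj, coe_pow_eq h k]
  rfl

/-- A subset of a subgroup which is closed under the group operations is a subgroup. -/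
theorem isSubgroup_of_subset (K : Subgrp L) {H : Set L} (hK : H ⊆ K) (h1 : one L ∈ H)
    (hm : ∀ a ∈ H, ∀ b ∈ H, a ⋆ b ∈ H) (hi : ∀ a ∈ H, a⁻¹ ∈ H) : IsSubgroup H where
  nonempty := ⟨_, h1⟩
  inv_mem := hi
  prod_mem w hw h := by
    induction w with
    | nil => exact h1
    | cons a w ih =>
      rw [prod_cons hw]
      exact hm _ (h a (by simp)) _ (ih (dom_tail hw) fun g hg => h g (by simp [hg]))
  word_mem w h := K.isSubgroup.word_mem w fun g hg => hK (h g hg)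

/-- A subgroup of the group `H`, seen as a subgroup of the partial group. -/
def ofSubgroup (H : Subgrp L) (K : Subgroup H) : Subgrp L where
  carrier := (fun a : H => (a : L)) '' (K : Set H)
  isSubgroup := by
    refine isSubgroup_of_subset H ?_ ⟨1, K.one_mem, rfl⟩ ?_ ?_
    · rintro _ ⟨a, _, rfl⟩
      exact a.2
    · rintro _ ⟨a, ha, rfl⟩ _ ⟨b, hb, rfl⟩
      exact ⟨a * b, K.mul_mem ha hb, rfl⟩
    · rintro _ ⟨a, ha, rfl⟩
      exact ⟨a⁻¹, K.inv_mem ha, rfl⟩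

theorem mem_ofSubgroup (H : Subgrp L) (K : Subgroup H) {a : L} :
    a ∈ H.ofSubgroup K ↔ ∃ h : a ∈ H, (⟨a, h⟩ : H) ∈ K := by
  constructor
  · rintro ⟨a, ha, rfl⟩
    exact ⟨a.2, ha⟩
  · rintro ⟨h, ha⟩
    exact ⟨⟨a, h⟩, ha, rfl⟩

theorem ofSubgroup_subset (H : Subgrp L) (K : Subgroup H) : (H.ofSubgroup K : Set L) ⊆ H := by
  rintro _ ⟨a, _, rfl⟩
  exact a.2

/-- The subgroup of the group `H` consisting of the elements of `P`. -/
def toSubgroup (H P : Subgrp L) : Subgroup H where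
  carrier := {a | (a : L) ∈ P}
  one_mem' := P.one_mem
  mul_mem' := fun {_ _} ha hb => P.pair_mem ha hb
  inv_mem' := fun {_} ha => P.inv_mem ha

@[simp] theorem mem_toSubgroup {H P : Subgrp L} {a : H} : a ∈ toSubgroup H P ↔ (a : L) ∈ P :=
  Iff.rfl

theorem isPGroup_ofSubgroup {p : ℕ} (H : Subgrp L) (K : Subgroup H) (hK : IsPGroup p K) :
    IsPGroup p (H.ofSubgroup K) := by
  rintro ⟨a, ha⟩
  obtain ⟨h, hK'⟩ := (mem_ofSubgroup H K).1 ha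
  obtain ⟨k, hk⟩ := hK ⟨⟨a, h⟩, hK'⟩
  refine ⟨k, Subtype.ext ?_⟩
  rw [coe_pow_eq _ h]
  exact congrArg (fun z : K => ((z : H) : L)) hk

end Subgrp

theorem coe_mem_elemsOfOrder {L : Type*} [PartialGroup L] {p : ℕ} {S : Subgrp L} {x : S} :
    (x : L) ∈ elemsOfOrder p S ↔ orderOf x = p := ⟨fun ⟨_, h⟩ => h, fun h => ⟨x.2, h⟩⟩

theorem mem_elemsOfOrder_iff {L : Type*} [PartialGroup L] {p : ℕ} {S P : Subgrp L}
    (h : (P : Set L) ⊆ S) {x : L} : x ∈ elemsOfOrder p P ↔ x ∈ P ∧ x ∈ elemsOfOrder p S := by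
  constructor
  · rintro ⟨hx, e⟩
    exact ⟨hx, h hx, (Subgrp.orderOf_eq _ _).trans e⟩
  · rintro ⟨hx, hS, e⟩
    exact ⟨hx, (Subgrp.orderOf_eq _ _).trans e⟩

/-! ### Conjugation of elements of `S` in a locality -/

/-- The conjugate `x ^ g` of `x ∈ S` is defined and equal to `y ∈ S`. -/
def Takes {L : Type*} [PartialGroup L] {S : Subgrp L} (x : S) (g : L) (y : S) : Prop :=
  (x : L) ∈ conjDom g ∧ conj g (x : L) = y

section Conjugation

variable {L : Type*} [PartialGroup L] {S : Subgrp L}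

theorem Takes.unique {x y y' : S} {g : L} (h : Takes x g y) (h' : Takes x g y') : y = y' :=
  Subtype.ext (h.2.symm.trans h'.2)

theorem Takes.inj {x x' y : S} {g : L} (h : Takes x g y) (h' : Takes x' g y) : x = x' :=
  Subtype.ext (conj_injOn h.1 h'.1 (h.2.trans h'.2.symm))

theorem Takes.inv {x y : S} {g : L} (h : Takes x g y) : Takes y g⁻¹ x := by
  refine ⟨h.2 ▸ conj_mem_conjDom_inv h.1, ?_⟩
  rw [← h.2, conj_inv_conj h.1]

theorem takes_one (g : L) : Takes (1 : S) g 1 := ⟨one_mem_conjDom g, conj_one g⟩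

theorem Takes.ne_one {x y : S} {g : L} (h : Takes x g y) (hx : x ≠ 1) : y ≠ 1 := by
  rintro rfl
  exact hx (h.inj (takes_one g))

theorem Takes.inv_inv {x y : S} {g : L} (h : Takes x g y) : Takes x⁻¹ g y⁻¹ :=
  ⟨(conj_inv_arg h.1).1, (conj_inv_arg h.1).2.trans (by rw [h.2]; rfl)⟩

/-- Elements of `S` act on `S` by conjugation in the group `S`. -/
theorem takes_coe (x s : S) : Takes x (s : L) (s⁻¹ * x * s) := by
  have hd : (x : L) ∈ conjDom (s : L) := S.triple_dom (s⁻¹).2 x.2 s.2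
  refine ⟨hd, conj_eq_of_mul_eq hd (S.pair_dom s.2 (s⁻¹ * x * s).2) ?_⟩
  rw [← Subgrp.coe_mul, ← Subgrp.coe_mul]
  congr 1
  group

theorem conjTo_self {P : Subgrp L} {a : L} (ha : a ∈ P) : ConjTo (P : Set L) a (P : Set L) := by
  have key : ∀ b : P, ∀ x : P, Takes x (b : L) (b⁻¹ * x * b) := fun b x => takes_coe x b
  refine ⟨fun x hx => (key ⟨a, ha⟩ ⟨x, hx⟩).1, ?_⟩
  ext y
  constructor
  · rintro ⟨x, hx, rfl⟩
    rw [(key ⟨a, ha⟩ ⟨x, hx⟩).2]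
    exact Subtype.property _
  · intro hy
    have h := key ⟨a, ha⟩ (⟨a, ha⟩ * ⟨y, hy⟩ * (⟨a, ha⟩)⁻¹)
    refine ⟨_, Subtype.property _, h.2.trans ?_⟩
    simp only [mul_assoc, _root_.inv_mul_cancel_left, inv_mul_cancel, mul_one]

end Conjugation

section Locality

variable {L : Type*} [PartialGroup L] {p : ℕ} {Δ : Set (Subgrp L)} {S : Subgrp L}

theorem IsLocality.dom_of_via (hL : IsLocality p Δ S) {P : Subgrp L} (hP : P ∈ Δ) {w : List L}
    (h : Via Δ P w) : w ∈ (D : Set (List L)) := (hL.mem_dom_iff w).2 ⟨P, hP, h⟩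

theorem IsLocality.exists_objects (hL : IsLocality p Δ S) (g : L) :
    ∃ P ∈ Δ, ∃ Q ∈ Δ, ConjTo (P : Set L) g (Q : Set L) := by
  obtain ⟨P, hP, Q, hQ, h, -⟩ := (hL.mem_dom_iff [g]).1 (singleton_mem g)
  exact ⟨P, hP, Q, hQ, h⟩

theorem IsLocality.exists_conjTo (hL : IsLocality p Δ S) {P : Subgrp L} (hP : P ∈ Δ) (a : S) :
    ∃ Q ∈ Δ, ConjTo (P : Set L) (a : L) (Q : Set L) := by
  refine hL.conj_mem P hP a fun x hx => ?_
  have hx : x ∈ S := hL.objects_le P hP hx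
  have h := takes_coe ⟨x, hx⟩ a
  exact ⟨hx, h.1, h.2 ▸ Subtype.property _⟩

/-- If `P ^ g = Q` for objects `P`, `Q`, and `a ^ g = b` for elements of `S`, then
`(P ^ a) ^ g = Q ^ b`; this holds because `g = a⁻¹ g b`. -/
theorem IsLocality.conjTo_translate (hL : IsLocality p Δ S) {P Q : Subgrp L} (hP : P ∈ Δ)
    (hQ : Q ∈ Δ) {g : L} (h : ConjTo (P : Set L) g (Q : Set L)) {a b : S} (hab : Takes a g b) :
    ∃ P' ∈ Δ, ∃ Q' ∈ Δ, ConjTo (P : Set L) (a : L) (P' : Set L) ∧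
      ConjTo (Q : Set L) (b : L) (Q' : Set L) ∧ ConjTo (P' : Set L) g (Q' : Set L) := by
  obtain ⟨P', hP', hPa⟩ := hL.exists_conjTo hP a
  obtain ⟨Q', hQ', hQb⟩ := hL.exists_conjTo hQ b
  refine ⟨P', hP', Q', hQ', hPa, hQb, ?_⟩
  have hgb : [g, (b : L)] ∈ (D : Set (List L)) :=
    hL.dom_of_via hP ⟨Q, hQ, h, Q', hQ', hQb, trivial⟩
  have hagb : [(a : L)⁻¹, g, (b : L)] ∈ (D : Set (List L)) :=
    hL.dom_of_via hP' ⟨P, hP, hPa.inv, Q, hQ, h, Q', hQ', hQb, trivial⟩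
  have hag : [(a : L), g] ∈ (D : Set (List L)) := dom_tail hab.1
  have e0 : g ⋆ (b : L) = (a : L) ⋆ g := by rw [← hab.2]; exact mul_conj hab.1
  have e2 : prod [(a : L)⁻¹, g, (b : L)] = g := by
    rw [prod_cons hagb, e0, inv_mul_cancel_left hag]
  have e1 : prod [(b : L)⁻¹, g⁻¹, (a : L)] = g⁻¹ := by
    have h1 : [(b : L)⁻¹, g⁻¹, (a : L)] ∈ (D : Set (List L)) := by
      simpa [PartialGroup.inv_inv] using dom_inv hagb
    have h2 := mul_inv_rev' (contract_mem [(a : L)⁻¹] [g, (b : L)] [] hagb)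
    rw [e0, inv_mul_cancel_left hag, ← e0, PartialGroup.inv_inv, mul_inv_rev' hgb,
      mul_assoc' h1] at h2
    exact (prod_cons h1).trans h2.symm
  have key : ∀ z ∈ (P' : Set L), z ∈ conjDom g ∧
      conj g z = conj (b : L) (conj g (conj (a : L)⁻¹ z)) := by
    intro z hz
    have hw : [(b : L)⁻¹, g⁻¹, (a : L), z, (a : L)⁻¹, g, (b : L)] ∈ (D : Set (List L)) :=
      hL.dom_of_via hQ' ⟨Q, hQ, hQb.inv, P, hP, h.inv, P', hP', hPa, P', hP', conjTo_self hz,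
        P, hP, hPa.inv, Q, hQ, h, Q', hQ', hQb, trivial⟩
    have h1 := prod_contract [] [(b : L)⁻¹, g⁻¹, (a : L)] _ hw
    have h2 := contract_mem [] [(b : L)⁻¹, g⁻¹, (a : L)] _ hw
    have h3 := prod_contract [g⁻¹, z] [(a : L)⁻¹, g, (b : L)] []
      (by simpa [e1] using h2)
    have h4 := contract_mem [g⁻¹, z] [(a : L)⁻¹, g, (b : L)] []
      (by simpa [e1] using h2)
    have h5 := prod_contract [(b : L)⁻¹, g⁻¹] [(a : L), z, (a : L)⁻¹] [g, (b : L)] hw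
    have h6 := contract_mem [(b : L)⁻¹, g⁻¹] [(a : L), z, (a : L)⁻¹] [g, (b : L)] hw
    have h7 := prod_contract [(b : L)⁻¹] [g⁻¹, _, g] [(b : L)] h6
    simp only [List.nil_append, List.cons_append, List.append_nil, e1, e2] at h1 h3 h4 h5 h7
    refine ⟨h4, ?_⟩
    have h8 : conj (a : L)⁻¹ z = prod [(a : L), z, (a : L)⁻¹] := by
      rw [conj, PartialGroup.inv_inv]
    rw [h8]
    exact h3.symm.trans (h1.symm.trans (h5.trans h7))
  refine ⟨fun z hz => (key z hz).1, ?_⟩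
  rw [← hQb.2, ← h.2, ← hPa.inv.2, Set.image_image, Set.image_image]
  exact Set.image_congr fun z hz => (key z hz).2

theorem IsLocality.takes_mul (hL : IsLocality p Δ S) {x y x' y' : S} {g : L} (h : Takes x g y)
    (h' : Takes x' g y') : Takes (x * x') g (y * y') := by
  obtain ⟨P, hP, Q, hQ, hPQ⟩ := hL.exists_objects g
  obtain ⟨P₁, hP₁, Q₁, hQ₁, hx, hy, h₁⟩ := hL.conjTo_translate hP hQ hPQ h
  obtain ⟨P₂, hP₂, Q₂, hQ₂, hx', hy', h₂⟩ := hL.conjTo_translate hP₁ hQ₁ h₁ h'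
  have hw : [g⁻¹, (x : L), (x' : L), g] ∈ (D : Set (List L)) :=
    hL.dom_of_via hQ ⟨P, hP, hPQ.inv, P₁, hP₁, hx, P₂, hP₂, hx', Q₂, hQ₂, h₂, trivial⟩
  have hv : [g⁻¹, (x : L), g, g⁻¹, (x' : L), g] ∈ (D : Set (List L)) :=
    hL.dom_of_via hQ ⟨P, hP, hPQ.inv, P₁, hP₁, hx, Q₁, hQ₁, h₁, P₁, hP₁, h₁.inv, P₂, hP₂, hx',
      Q₂, hQ₂, h₂, trivial⟩
  have hd : ((x * x' : S) : L) ∈ conjDom g := contract_mem [g⁻¹] [(x : L), (x' : L)] [g] hw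
  refine ⟨hd, ?_⟩
  have h1 := prod_contract [g⁻¹] [(x : L), (x' : L)] [g] hw
  have h2 := prod_contract [] [g⁻¹, (x : L), g] [g⁻¹, (x' : L), g] hv
  have h3 := contract_mem [] [g⁻¹, (x : L), g] [g⁻¹, (x' : L), g] hv
  have h4 := prod_contract [conj g (x : L)] [g⁻¹, (x' : L), g] [] h3
  have h5 := prod_contract [g⁻¹, (x : L)] [g, g⁻¹] [(x' : L), g] hv
  have h6 := contract_mem [g⁻¹, (x : L)] [g, g⁻¹] [(x' : L), g] hv
  have h7 := prod_contract [g⁻¹, (x : L)] [one L, (x' : L)] [g]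
    (by simpa [prod_inv_right] using h6)
  simp only [List.nil_append, List.cons_append, List.append_nil, prod_inv_right,
    prod_one_left] at h1 h2 h4 h5 h7
  have e : conj g ((x * x' : S) : L) = conj g (x : L) ⋆ conj g (x' : L) :=
    h1.symm.trans (h7.symm.trans (h5.symm.trans (h2.trans h4)))
  rw [e, h.2, h'.2]
  rfl

/-- The subgroup `S_g` of all `x ∈ S` for which `x ^ g` is defined and lies in `S`. -/
def IsLocality.stab (hL : IsLocality p Δ S) (g : L) : Subgroup S where
  carrier := {x | ∃ y, Takes x g y}
  one_mem' := ⟨1, takes_one g⟩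
  mul_mem' := fun {_ _} ⟨_, h⟩ ⟨_, h'⟩ => ⟨_, hL.takes_mul h h'⟩
  inv_mem' := fun {_} ⟨_, h⟩ => ⟨_, h.inv_inv⟩

theorem IsLocality.takes_pow (hL : IsLocality p Δ S) {x y : S} {g : L} (h : Takes x g y) (n : ℕ) :
    Takes (x ^ n) g (y ^ n) := by
  induction n with
  | zero => simpa using takes_one g
  | succ n ih => rw [pow_succ, pow_succ]; exact hL.takes_mul ih h

theorem IsLocality.takes_zpow (hL : IsLocality p Δ S) {x y : S} {g : L} (h : Takes x g y)
    (n : ℤ) : Takes (x ^ n) g (y ^ n) := by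
  cases n with
  | ofNat n => simpa using hL.takes_pow h n
  | negSucc n => simpa using (hL.takes_pow h (n + 1)).inv_inv

theorem IsLocality.orderOf_eq (hL : IsLocality p Δ S) {x y : S} {g : L} (h : Takes x g y) :
    orderOf x = orderOf y := by
  refine orderOf_eq_orderOf_iff.2 fun n => ⟨fun e => ?_, fun e => ?_⟩
  · have h1 := hL.takes_pow h n
    rw [e] at h1
    exact h1.unique (takes_one g)
  · have h1 := hL.takes_pow h n
    rw [e] at h1
    exact h1.inj (takes_one g)

end Locality

/-! ### Words and normalizers in a punctured group -/

/-- The word `w = (f₁, …, fₙ)` conjugates `x ∈ S` to `y ∈ S` through elements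
`x ^ f₁, (x ^ f₁) ^ f₂, …` of `S`. -/
def Path {L : Type*} [PartialGroup L] {S : Subgrp L} : S → List L → S → Prop
  | x, [], y => x = y
  | x, f :: w, y => ∃ z, Takes x f z ∧ Path z w y

section Punctured

variable {L : Type*} [PartialGroup L] {p : ℕ} {Δ : Set (Subgrp L)} {S : Subgrp L}

theorem IsPuncturedGroup.ofSubgroup_mem (hL : IsPuncturedGroup p Δ S) {Q : Subgroup S}
    (hQ : Q ≠ ⊥) : S.ofSubgroup Q ∈ Δ := by
  refine (hL.mem_objects_iff _).2 ⟨S.ofSubgroup_subset Q, fun h => hQ ?_⟩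
  refine (Subgroup.eq_bot_iff_forall Q).2 fun x hx => ?_
  have h1 : (x : L) ∈ (S.ofSubgroup Q : Set L) := ⟨x, hx, rfl⟩
  rw [h] at h1
  exact Subtype.ext h1

theorem IsPuncturedGroup.subset (hL : IsPuncturedGroup p Δ S) {P : Subgrp L} (hP : P ∈ Δ) :
    (P : Set L) ⊆ S := hL.objects_le P hP

theorem IsPuncturedGroup.toSubgroup_ne_bot (hL : IsPuncturedGroup p Δ S) {P : Subgrp L}
    (hP : P ∈ Δ) : S.toSubgroup P ≠ ⊥ := by
  intro h
  refine ((hL.mem_objects_iff P).1 hP).2 (Set.eq_singleton_iff_unique_mem.2 ⟨P.one_mem, ?_⟩)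
  intro x hx
  have h1 : (⟨x, hL.subset hP hx⟩ : S) ∈ S.toSubgroup P := hx
  rw [h, Subgroup.mem_bot] at h1
  exact congrArg (fun z : S => (z : L)) h1

theorem IsPuncturedGroup.conjTo_zpowers (hL : IsPuncturedGroup p Δ S) {x y : S} {g : L}
    (h : Takes x g y) : ConjTo (S.ofSubgroup (Subgroup.zpowers x) : Set L) g
      (S.ofSubgroup (Subgroup.zpowers y) : Set L) := by
  refine ⟨?_, ?_⟩
  · rintro _ ⟨_, ⟨n, rfl⟩, rfl⟩
    exact (hL.takes_zpow h n).1
  · ext z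
    constructor
    · rintro ⟨_, ⟨_, ⟨n, rfl⟩, rfl⟩, rfl⟩
      exact ⟨y ^ n, ⟨n, rfl⟩, (hL.takes_zpow h n).2.symm⟩
    · rintro ⟨_, ⟨n, rfl⟩, rfl⟩
      exact ⟨_, ⟨x ^ n, ⟨n, rfl⟩, rfl⟩, (hL.takes_zpow h n).2⟩

theorem IsPuncturedGroup.via_of_path (hL : IsPuncturedGroup p Δ S) {x y : S} (hx : x ≠ 1)
    {w : List L} (h : Path x w y) : Via Δ (S.ofSubgroup (Subgroup.zpowers x)) w := by
  induction w generalizing x with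
  | nil => trivial
  | cons f w ih =>
    obtain ⟨z, hz, hw⟩ := h
    have hz1 := hz.ne_one hx
    exact ⟨_, hL.ofSubgroup_mem (by simpa using hz1), hL.conjTo_zpowers hz, ih hz1 hw⟩

theorem IsPuncturedGroup.dom_of_path (hL : IsPuncturedGroup p Δ S) {x y : S} (hx : x ≠ 1)
    {w : List L} (h : Path x w y) : w ∈ (D : Set (List L)) :=
  hL.dom_of_via (hL.ofSubgroup_mem (by simpa using hx)) (hL.via_of_path hx h)

theorem IsPuncturedGroup.exists_path_of_via (hL : IsPuncturedGroup p Δ S) {w : List L}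
    {P : Subgrp L} (h : Via Δ P w) {x : S} (hx : (x : L) ∈ P) :
    ∃ y, Path x w y := by
  induction w generalizing x P with
  | nil => exact ⟨x, rfl⟩
  | cons f w ih =>
    obtain ⟨Q, hQ, hPQ, hw⟩ := h
    have h1 : conj f (x : L) ∈ (Q : Set L) := hPQ.2 ▸ ⟨_, hx, rfl⟩
    obtain ⟨y, hy⟩ := ih hw (x := ⟨_, hL.subset hQ h1⟩) h1
    exact ⟨y, _, ⟨hPQ.1 hx, rfl⟩, hy⟩

theorem IsPuncturedGroup.exists_orderOf (hL : IsPuncturedGroup p Δ S) [Fact p.Prime]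
    {Q : Subgroup S} (hQ : Q ≠ ⊥) : ∃ x ∈ Q, orderOf x = p := by
  have := hL.finite
  have : Nontrivial Q := (Subgroup.nontrivial_iff_ne_bot Q).2 hQ
  obtain ⟨n, hn, h⟩ := (hL.isPGroup.to_subgroup Q).nontrivial_iff_card.1 this
  obtain ⟨x, hx⟩ := exists_prime_orderOf_dvd_card' (G := Q) p (h ▸ dvd_pow_self p hn.ne')
  exact ⟨x, x.2, by rwa [Subgroup.orderOf_coe]⟩

/-- The domain of the product of a punctured group in terms of elements of order `p`. -/
theorem IsPuncturedGroup.exists_path (hL : IsPuncturedGroup p Δ S) [Fact p.Prime] {w : List L}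
    (h : w ∈ (D : Set (List L))) : ∃ x y : S, orderOf x = p ∧ Path x w y := by
  obtain ⟨P, hP, hw⟩ := (hL.mem_dom_iff w).1 h
  obtain ⟨x, hx, hp⟩ := hL.exists_orderOf (hL.toSubgroup_ne_bot hP)
  obtain ⟨y, hy⟩ := hL.exists_path_of_via hw (x := x) hx
  exact ⟨x, y, hp, hy⟩

theorem ne_one_of_orderOf [Fact p.Prime] {x : S} (h : orderOf x = p) : x ≠ 1 := by
  rintro rfl
  rw [orderOf_one] at h
  exact (Fact.out : p.Prime).one_lt.ne h

theorem IsPuncturedGroup.comp_dom (hL : IsPuncturedGroup p Δ S) {x y z : S} (hx : x ≠ 1)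
    {g h : L} (h1 : Takes x g y) (h2 : Takes y h z) : [g, h] ∈ (D : Set (List L)) :=
  hL.dom_of_path hx ⟨y, h1, z, h2, rfl⟩

theorem IsPuncturedGroup.assoc (hL : IsPuncturedGroup p Δ S) {x y z u : S} (hx : x ≠ 1)
    {g h k : L} (h1 : Takes x g y) (h2 : Takes y h z) (h3 : Takes z k u) :
    (g ⋆ h) ⋆ k = g ⋆ (h ⋆ k) :=
  mul_assoc' (hL.dom_of_path hx ⟨y, h1, z, h2, u, h3, rfl⟩)

theorem IsPuncturedGroup.comp (hL : IsPuncturedGroup p Δ S) {x y z : S} (hx : x ≠ 1)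
    {g h : L} (h1 : Takes x g y) (h2 : Takes y h z) : Takes x (g ⋆ h) z := by
  have hw : [h⁻¹, g⁻¹, (x : L), g, h] ∈ (D : Set (List L)) :=
    hL.dom_of_path (h2.ne_one (h1.ne_one hx))
      ⟨y, h2.inv, x, h1.inv, x, by simpa using takes_coe x x, y, h1, z, h2, rfl⟩
  have h3 := contract_mem [] [h⁻¹, g⁻¹] _ hw
  have h4 := prod_contract [] [h⁻¹, g⁻¹] _ hw
  have e := mul_inv_rev' (hL.comp_dom hx h1 h2)
  simp only [List.nil_append, List.cons_append, ← e] at h3 h4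
  have h5 := contract_mem [(g ⋆ h)⁻¹, (x : L)] [g, h] [] h3
  have h6 := prod_contract [(g ⋆ h)⁻¹, (x : L)] [g, h] [] h3
  have h7 := prod_contract [h⁻¹] [g⁻¹, (x : L), g] [h] hw
  refine ⟨h5, ?_⟩
  have h8 : conj (g ⋆ h) (x : L) = conj h (conj g (x : L)) :=
    h6.symm.trans (h4.symm.trans h7)
  rw [h8, h1.2, h2.2]

theorem IsPuncturedGroup.takes_prod (hL : IsPuncturedGroup p Δ S) {x y : S} (hx : x ≠ 1)
    {w : List L} (h : Path x w y) : Takes x (prod w) y := by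
  induction w generalizing x with
  | nil =>
    obtain rfl : x = y := h
    have := takes_coe x 1
    simpa [one] using this
  | cons f w ih =>
    rw [prod_cons (hL.dom_of_path hx h)]
    obtain ⟨z, hz, hw⟩ := h
    exact hL.comp hx hz (ih (hz.ne_one hx) hw)

theorem takes_one_right (x : S) : Takes x (one L) x := by
  simpa using takes_coe x 1

/-- Cancellation of a first factor `g` with `x ^ g ∈ S`. -/
theorem IsPuncturedGroup.inv_mul_cancel (hL : IsPuncturedGroup p Δ S) {x y z : S} (hx : x ≠ 1)
    {g h : L} (h1 : Takes x g y) (h2 : Takes y h z) : g⁻¹ ⋆ (g ⋆ h) = h :=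
  inv_mul_cancel_left (hL.comp_dom hx h1 h2)

theorem IsPuncturedGroup.cancel_left (hL : IsPuncturedGroup p Δ S) {x y z u : S} (hx : x ≠ 1)
    {g h k : L} (h1 : Takes x g y) (h2 : Takes y h z) (h3 : Takes y k u) (e : g ⋆ h = g ⋆ k) :
    h = k := mul_left_cancel (hL.comp_dom hx h1 h2) (hL.comp_dom hx h1 h3) e

theorem IsPuncturedGroup.mul_inv_cancel_right (hL : IsPuncturedGroup p Δ S) {x y z : S}
    (hx : x ≠ 1) {g h : L} (h1 : Takes x g y) (h2 : Takes y h z) : (g ⋆ h) ⋆ h⁻¹ = g := by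
  rw [hL.assoc hx h1 h2 h2.inv, prod_inv_right, prod_one_right]

theorem IsPuncturedGroup.cancel_right (hL : IsPuncturedGroup p Δ S) {x x' y y' z : S}
    (hx : x ≠ 1) (hx' : x' ≠ 1) {g g' h : L} (h1 : Takes x g y) (h2 : Takes y h z)
    (h1' : Takes x' g' y') (h2' : Takes y' h z') (e : g ⋆ h = g' ⋆ h) : g = g' := by
  rw [← hL.mul_inv_cancel_right hx h1 h2, e, hL.mul_inv_cancel_right hx' h1' h2']

/-- If `s g = g t` with `s, t ∈ S` and `x ^ g` and `(x ^ s) ^ g` lie in `S` for some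
`x ≠ 1`, then `s ^ g` is defined and equal to `t`. -/
theorem IsPuncturedGroup.takes_of_mul_eq (hL : IsPuncturedGroup p Δ S) {x y z s t : S}
    (hx : x ≠ 1) {g : L} (h1 : Takes x g y) (h2 : Takes (s⁻¹ * x * s) g z)
    (e : (s : L) ⋆ g = g ⋆ (t : L)) : Takes s g t := by
  have hd : (s : L) ∈ conjDom g :=
    hL.dom_of_path (h1.ne_one hx) ⟨x, h1.inv, _, takes_coe x s, z, h2, rfl⟩
  exact ⟨hd, conj_eq_of_mul_eq hd (hL.comp_dom hx h1 (takes_coe y t)) e⟩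

theorem Takes.mul_eq {s t : S} {g : L} (h : Takes s g t) : (s : L) ⋆ g = g ⋆ (t : L) := by
  rw [← h.2]
  exact (mul_conj h.1).symm

theorem IsPuncturedGroup.mem_normalizer (hL : IsPuncturedGroup p Δ S) {P : Subgrp L}
    (hP : (P : Set L) ⊆ S) {g : L} : g ∈ normalizer (P : Set L) ↔
      ∀ x ∈ S.toSubgroup P, ∃ y ∈ S.toSubgroup P, Takes x g y := by
  have := hL.finite
  constructor
  · intro h x hx
    have h1 : conj g (x : L) ∈ (P : Set L) := h.2 ▸ ⟨_, hx, rfl⟩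
    exact ⟨⟨_, hP h1⟩, h1, h.1 hx, rfl⟩
  · intro h
    have h1 : (P : Set L) ⊆ conjDom g := fun x hx =>
      let ⟨_, _, h2⟩ := h ⟨x, hP hx⟩ hx
      h2.1
    refine ⟨h1, ?_⟩
    have h2 : conj g '' (P : Set L) ⊆ P := by
      rintro _ ⟨x, hx, rfl⟩
      obtain ⟨y, hy, h2⟩ := h ⟨x, hP hx⟩ hx
      rw [h2.2]
      exact hy
    refine Set.eq_of_subset_of_ncard_le h2 ?_ (Set.toFinite _)
    rw [Set.InjOn.ncard_image fun x hx y hy e => conj_injOn (h1 hx) (h1 hy) e]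

/-- The normalizer of an object is a subgroup. -/
theorem IsPuncturedGroup.isSubgroup_normalizer (hL : IsPuncturedGroup p Δ S) {P : Subgrp L}
    (hP : P ∈ Δ) : IsSubgroup (normalizer (P : Set L)) := by
  have hPS := hL.subset hP
  obtain ⟨⟨x, hx⟩, hx1⟩ := Subgroup.ne_bot_iff_exists_ne_one.1 (hL.toSubgroup_ne_bot hP)
  replace hx1 : x ≠ 1 := fun h => hx1 (Subtype.ext h)
  have path : ∀ (w : List L), (∀ g ∈ w, g ∈ normalizer (P : Set L)) →
      ∀ x ∈ S.toSubgroup P, ∃ y ∈ S.toSubgroup P, Path x w y := by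
    intro w
    induction w with
    | nil => exact fun _ x hx => ⟨x, hx, rfl⟩
    | cons f w ih =>
      intro h x hx
      obtain ⟨z, hz, h1⟩ := (hL.mem_normalizer hPS).1 (h f (by simp)) x hx
      obtain ⟨y, hy, h2⟩ := ih (fun g hg => h g (by simp [hg])) z hz
      exact ⟨y, hy, z, h1, h2⟩
  refine ⟨⟨⟨one L, (hL.mem_normalizer hPS).2 fun x hx => ⟨x, hx, takes_one_right x⟩⟩,
    fun g hg => ConjTo.inv hg, ?_⟩, ?_⟩
  · refine fun w _ h => (hL.mem_normalizer hPS).2 fun x hx => ?_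
    by_cases hx1 : x = 1
    · subst hx1
      exact ⟨1, one_mem _, takes_one _⟩
    · obtain ⟨y, hy, h1⟩ := path w h x hx
      exact ⟨y, hy, hL.takes_prod hx1 h1⟩
  · intro w h
    obtain ⟨y, -, h1⟩ := path w h x hx
    exact hL.dom_of_path hx1 h1

/-- The normalizer `N_L(P)` of an object `P`, as a subgroup of the partial group. -/
def IsPuncturedGroup.normalizerSubgrp (hL : IsPuncturedGroup p Δ S) {P : Subgrp L}
    (hP : P ∈ Δ) : Subgrp L := ⟨normalizer (P : Set L), hL.isSubgroup_normalizer hP⟩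

theorem IsPuncturedGroup.mem_normalizerSubgrp (hL : IsPuncturedGroup p Δ S) {P : Subgrp L}
    (hP : P ∈ Δ) {g : L} : g ∈ hL.normalizerSubgrp hP ↔
      ∀ x ∈ S.toSubgroup P, ∃ y ∈ S.toSubgroup P, Takes x g y :=
  hL.mem_normalizer (hL.subset hP)

/-- The normalizer condition in the `p`-group `S`: a proper subgroup `A` of `B` is
normalized by some element of `B` outside `A`. -/
theorem IsPuncturedGroup.exists_normalizing (hL : IsPuncturedGroup p Δ S) [Fact p.Prime]
    {A B : Subgroup S} (hAB : A ≤ B) (h : ¬ B ≤ A) : ∃ s ∈ B, s ∉ A ∧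
      s ∈ Subgroup.normalizer (A : Set S) := by
  have := hL.finite
  have hB : IsPGroup p B := hL.isPGroup.to_subgroup B
  have : Group.IsNilpotent B := hB.isNilpotent
  have hlt : A.subgroupOf B < ⊤ := by
    rw [lt_top_iff_ne_top, Ne, Subgroup.subgroupOf_eq_top]
    exact h
  obtain ⟨s, hs, hsA⟩ := SetLike.exists_of_lt (Group.normalizerCondition_of_isNilpotent _ hlt)
  refine ⟨s, s.2, hsA, Subgroup.mem_normalizer_iff.2 fun x => ?_⟩
  have h1 := Subgroup.mem_normalizer_iff.1 hs
  constructor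
  · intro hx
    exact (h1 ⟨x, hAB hx⟩).1 hx
  · intro hx
    have hxB : x ∈ B := by
      have := B.mul_mem (B.mul_mem (B.inv_mem s.2) (hAB hx)) s.2
      simpa [mul_assoc] using this
    exact (h1 ⟨x, hxB⟩).2 hx

end Punctured

/-! ### The elements of the signalizers -/

section Signalizers

variable {L : Type*} [PartialGroup L] {p : ℕ} {Δ : Set (Subgrp L)} {S : Subgrp L} {θ : L → Set L}

/-- The subgroup of those elements of `S` which `n` centralizes. -/
def IsPuncturedGroup.fix (hL : IsPuncturedGroup p Δ S) (n : L) : Subgroup S where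
  carrier := {s | Takes s n s}
  one_mem' := takes_one n
  mul_mem' := fun {_ _} h h' => hL.takes_mul h h'
  inv_mem' := fun {_} h => h.inv_inv

theorem IsPuncturedGroup.exists_central (hL : IsPuncturedGroup p Δ S) [Fact p.Prime]
    {Q : Subgroup S} (hQ : Q ≠ ⊥) : ∃ z ∈ Q, orderOf z = p ∧ ∀ x ∈ Q, z * x = x * z := by
  have := hL.finite
  have : Nontrivial Q := (Subgroup.nontrivial_iff_ne_bot Q).2 hQ
  have h1 := (hL.isPGroup.to_subgroup Q).center_nontrivial
  have h2 : (Subgroup.center Q).map Q.subtype ≠ ⊥ := by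
    rw [Ne, (Subgroup.center Q).map_eq_bot_iff_of_injective Q.subtype_injective]
    exact (Subgroup.nontrivial_iff_ne_bot _).1 h1
  obtain ⟨_, ⟨z, hz, rfl⟩, hp⟩ := hL.exists_orderOf h2
  refine ⟨z, z.2, hp, fun x hx => ?_⟩
  have := Subgroup.mem_center_iff.1 hz ⟨x, hx⟩
  exact (congrArg (fun y : Q => (y : S)) this).symm

namespace IsSignalizerFunctor

theorem isSubgroup (hθ : IsSignalizerFunctor p S θ) {a : S} (ha : orderOf a = p) :
    IsSubgroup (θ a) := (hθ.normal a (coe_mem_elemsOfOrder.2 ha)).isSubgroup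

/-- The group `θ(a)`. -/
def subgrp (hθ : IsSignalizerFunctor p S θ) {a : S} (ha : orderOf a = p) : Subgrp L :=
  ⟨θ a, hθ.isSubgroup ha⟩

theorem mul_mem (hθ : IsSignalizerFunctor p S θ) {a : S} (ha : orderOf a = p) {m n : L}
    (hm : m ∈ θ a) (hn : n ∈ θ a) : m ⋆ n ∈ θ a := (hθ.subgrp ha).pair_mem hm hn

theorem inv_mem (hθ : IsSignalizerFunctor p S θ) {a : S} (ha : orderOf a = p) {m : L}
    (hm : m ∈ θ a) : m⁻¹ ∈ θ a := (hθ.subgrp ha).inv_mem hm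

theorem one_mem (hθ : IsSignalizerFunctor p S θ) {a : S} (ha : orderOf a = p) :
    one L ∈ θ a := (hθ.subgrp ha).one_mem

theorem takes (hθ : IsSignalizerFunctor p S θ) {a : S} (ha : orderOf a = p) {n : L}
    (hn : n ∈ θ a) : Takes a n a :=
  (hθ.normal a (coe_mem_elemsOfOrder.2 ha)).subset hn a rfl

theorem conjTo (hθ : IsSignalizerFunctor p S θ) {a b : S} (ha : orderOf a = p) {g : L}
    (h : Takes a g b) : ConjTo (θ a) g (θ b) := by
  have := hθ.conjugacy a (coe_mem_elemsOfOrder.2 ha) g h.1 (h.2 ▸ b.2)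
  rwa [h.2] at this

/-- An element of `θ(a)` can be moved to the right of `g`, when `a ^ g ∈ S`. -/
theorem exists_mul_right (hθ : IsSignalizerFunctor p S θ) {a b : S} (ha : orderOf a = p) {g n : L}
    (h : Takes a g b) (hn : n ∈ θ a) : ∃ m ∈ θ b, n ⋆ g = g ⋆ m := by
  have h1 := hθ.conjTo ha h
  exact ⟨conj g n, h1.2 ▸ ⟨n, hn, rfl⟩, (mul_conj (h1.1 hn)).symm⟩

/-- An element of `θ(a ^ g)` can be moved to the left of `g`. -/
theorem exists_mul_left (hθ : IsSignalizerFunctor p S θ) {a b : S} (ha : orderOf a = p) {g m : L}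
    (h : Takes a g b) (hm : m ∈ θ b) : ∃ n ∈ θ a, n ⋆ g = g ⋆ m := by
  have h1 := hθ.conjTo ha h
  rw [← h1.2] at hm
  obtain ⟨n, hn, rfl⟩ := hm
  exact ⟨n, hn, (mul_conj (h1.1 hn)).symm⟩

theorem mem_of_commute (hθ : IsSignalizerFunctor p S θ) {a b : S} (ha : orderOf a = p)
    (hb : orderOf b = p) (hab : a * b = b * a) {n : L} (hn : n ∈ θ a) (h : Takes b n b) :
    n ∈ θ b := by
  refine hθ.balance a (coe_mem_elemsOfOrder.2 ha) b (coe_mem_elemsOfOrder.2 hb) ?_ ⟨hn, ?_⟩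
  · have hw : [(a : L)⁻¹, (b : L)⁻¹, (a : L), (b : L)] ∈ (D : Set (List L)) := by
      refine S.isSubgroup.word_mem _ ?_
      simp only [List.mem_cons, List.not_mem_nil, or_false, forall_eq_or_imp, forall_eq]
      exact ⟨(a⁻¹).2, (b⁻¹).2, a.2, b.2⟩
    rw [prod_cons hw, prod_cons (dom_tail hw)]
    have h1 : a⁻¹ * (b⁻¹ * (a * b)) = 1 := by rw [hab]; group
    exact congrArg (fun z : S => (z : L)) h1
  · rintro _ rfl
    exact h

/-- The `p'`-group `θ(a)` meets the `p`-group `S` trivially. -/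
theorem eq_one (hθ : IsSignalizerFunctor p S θ) [Fact p.Prime] [Finite L]
    (hS : IsPGroup p S) {a : S} (ha : orderOf a = p) {u : S} (hu : (u : L) ∈ θ a) : u = 1 := by
  obtain ⟨k, hk⟩ := IsPGroup.iff_orderOf.1 hS u
  have h1 : orderOf u = orderOf (⟨u, hu⟩ : hθ.subgrp ha) := Subgrp.orderOf_eq _ _
  have h2 : orderOf (⟨u, hu⟩ : hθ.subgrp ha) ∣ Nat.card (hθ.subgrp ha) := orderOf_dvd_natCard _
  rw [← h1, hk] at h2
  rcases k with - | k
  · rw [← orderOf_eq_one_iff, hk, pow_zero]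
  · exact absurd ((dvd_pow_self p k.succ_ne_zero).trans h2)
      (hθ.normal a (coe_mem_elemsOfOrder.2 ha)).not_dvd

/-- An element of some `θ(a)` lies in `θ(x)` for every `x` of order `p` that it centralizes:
pass from `a` to `x` through an element of order `p` in the center of the centralizer in `S`. -/
theorem mem_of_fix (hθ : IsSignalizerFunctor p S θ) (hL : IsPuncturedGroup p Δ S)
    [Fact p.Prime] {a x : S} (ha : orderOf a = p) (hx : orderOf x = p) {n : L} (hn : n ∈ θ a)
    (h : Takes x n x) : n ∈ θ x := by
  have haC : a ∈ hL.fix n := hθ.takes ha hn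
  have hC : hL.fix n ≠ ⊥ := fun e => ne_one_of_orderOf ha (by simpa [e] using haC)
  obtain ⟨z, hz, hzp, hc⟩ := hL.exists_central hC
  exact hθ.mem_of_commute hzp hx (hc x h) (hθ.mem_of_commute ha hzp (hc a haC).symm hn hz) h

/-- An element `n` of a signalizer centralizes every `s ∈ S` with `s ^ n ∈ S`. Otherwise the
normalizer condition gives such an `s` which normalizes `C_S(n)` but is not contained in it, and
then the commutator of `n` and `s` is a nonidentity element of `S` in a signalizer. -/
theorem takes_eq (hθ : IsSignalizerFunctor p S θ) (hL : IsPuncturedGroup p Δ S)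
    [Fact p.Prime] {a s t : S} (ha : orderOf a = p) {n : L} (hn : n ∈ θ a) (h : Takes s n t) :
    t = s := by
  have hfin := hL.finite
  have haC : a ∈ hL.fix n := hθ.takes ha hn
  have hC : hL.fix n ≠ ⊥ := fun e => ne_one_of_orderOf ha (by simpa [e] using haC)
  have hle : hL.fix n ≤ hL.stab n := fun x hx => ⟨x, hx⟩
  suffices hst : hL.stab n ≤ hL.fix n from h.unique (hst ⟨t, h⟩)
  by_contra hst
  obtain ⟨s, ⟨t, h⟩, hsC, hsN⟩ := hL.exists_normalizing hle hst
  obtain ⟨z, hz, hzp, -⟩ := hL.exists_central hC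
  have hz1 := ne_one_of_orderOf hzp
  have hzs : Takes z (s : L) (s⁻¹ * z * s) := takes_coe z s
  have hz'C : s⁻¹ * z * s ∈ hL.fix n := by
    have := (Subgroup.mem_normalizer_iff.1 ((Subgroup.normalizer _).inv_mem hsN) z).1 hz
    simpa using this
  set z' := s⁻¹ * z * s with hz'
  have hz'p : orderOf z' = p := (hL.orderOf_eq hzs).symm.trans hzp
  have hnz : n ∈ θ z := hθ.mem_of_fix hL ha hzp hn hz
  have hnz' : n ∈ θ z' := hθ.mem_of_fix hL ha hz'p hn hz'C
  obtain ⟨m, hm, e⟩ := hθ.exists_mul_right hzp hzs hnz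
  have hm' := hθ.takes hz'p hm
  have hzt : Takes z (t : L) z' := by
    have h1 := hL.takes_mul (hL.takes_mul h.inv_inv hz) h
    have h2 : Takes z (t : L) (t⁻¹ * z * t) := takes_coe z t
    rwa [h1.unique hz'C] at h2
  -- the element `u = t⁻¹ s` of `S` satisfies `n u = m`
  have hu : Takes z' ((t⁻¹ * s : S) : L) z' := hL.comp (ne_one_of_orderOf hz'p) hzt.inv hzs
  have e1 : n ⋆ ((t⁻¹ * s : S) : L) = m := by
    refine hL.cancel_left hz1 hzs (hL.comp (ne_one_of_orderOf hz'p) hz'C hu) hm' ?_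
    rw [← hL.assoc hz1 hzs hz'C hu, h.mul_eq, hL.assoc hz1 hz hzt hu, ← e, ← Subgrp.coe_mul]
    congr 3
    group
  have e2 : ((t⁻¹ * s : S) : L) ∈ θ z' := by
    rw [← hL.inv_mul_cancel (ne_one_of_orderOf hz'p) hz'C hu, e1]
    exact hθ.mul_mem hz'p (hθ.inv_mem hz'p hnz') hm
  have e3 := hθ.eq_one hL.isPGroup hz'p e2
  rw [inv_mul_eq_one.1 e3] at h
  exact hsC h

theorem mem_of_takes (hθ : IsSignalizerFunctor p S θ) (hL : IsPuncturedGroup p Δ S)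
    [Fact p.Prime] {a x y : S} (ha : orderOf a = p) (hx : orderOf x = p) {n : L} (hn : n ∈ θ a)
    (h : Takes x n y) : n ∈ θ x :=
  hθ.mem_of_fix hL ha hx hn (by rwa [hθ.takes_eq hL ha hn h] at h)

end IsSignalizerFunctor

/-! ### The union of the signalizers is a partial normal subgroup -/

theorem mem_unionOf {n : L} : n ∈ unionOf p S θ ↔ ∃ a : S, orderOf a = p ∧ n ∈ θ a := by
  simp only [unionOf, Set.mem_iUnion, exists_prop]
  constructor
  · rintro ⟨a, ⟨haS, ha⟩, hn⟩
    exact ⟨⟨a, haS⟩, ha, hn⟩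
  · rintro ⟨a, ha, hn⟩
    exact ⟨a, ⟨a.2, ha⟩, hn⟩

end Signalizers

section Union

variable {L : Type*} [PartialGroup L] {p : ℕ} {Δ : Set (Subgrp L)} {S : Subgrp L} {θ : L → Set L}

namespace IsSignalizerFunctor

theorem takes_of_mem_union (hθ : IsSignalizerFunctor p S θ) (hL : IsPuncturedGroup p Δ S)
    [Fact p.Prime] {n : L} (hn : n ∈ unionOf p S θ) {s t : S} (h : Takes s n t) :
    Takes s n s := by
  obtain ⟨a, ha, hn⟩ := mem_unionOf.1 hn
  rwa [hθ.takes_eq hL ha hn h] at h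

theorem mem_of_mem_union (hθ : IsSignalizerFunctor p S θ) (hL : IsPuncturedGroup p Δ S)
    [Fact p.Prime] {n : L} (hn : n ∈ unionOf p S θ) {x y : S} (hx : orderOf x = p)
    (h : Takes x n y) : n ∈ θ x := by
  obtain ⟨a, ha, hn⟩ := mem_unionOf.1 hn
  exact hθ.mem_of_takes hL ha hx hn h

theorem mem_union {a : S} (ha : orderOf a = p) {n : L} (hn : n ∈ θ a) : n ∈ unionOf p S θ :=
  mem_unionOf.2 ⟨a, ha, hn⟩

theorem exists_takes (hθ : IsSignalizerFunctor p S θ) (hL : IsPuncturedGroup p Δ S)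
    [Fact p.Prime] {n f : L} (hn : n ∈ unionOf p S θ) (h : [n, f] ∈ (D : Set (List L))) :
    ∃ x y : S, orderOf x = p ∧ n ∈ θ x ∧ Takes x f y := by
  obtain ⟨x, y, hx, z, h1, y', h2, -⟩ := hL.exists_path h
  obtain rfl := h1.unique (hθ.takes_of_mem_union hL hn h1)
  exact ⟨_, y', hx, hθ.mem_of_mem_union hL hn hx h1, h2⟩

theorem one_mem_union (hθ : IsSignalizerFunctor p S θ) (hL : IsPuncturedGroup p Δ S)
    [Fact p.Prime] : one L ∈ unionOf p S θ := by
  obtain ⟨x, -, hx, -⟩ := hL.exists_path nil_mem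
  exact mem_union hx (hθ.one_mem hx)

theorem inv_mem_union (hθ : IsSignalizerFunctor p S θ) {n : L} (hn : n ∈ unionOf p S θ) :
    n⁻¹ ∈ unionOf p S θ := by
  obtain ⟨a, ha, hn⟩ := mem_unionOf.1 hn
  exact mem_union ha (hθ.inv_mem ha hn)

theorem isPartialNormalPPrime (hθ : IsSignalizerFunctor p S θ) (hL : IsPuncturedGroup p Δ S)
    [Fact p.Prime] : IsPartialNormalPPrime S (unionOf p S θ) where
  nonempty := ⟨_, hθ.one_mem_union hL⟩
  inv_mem _ := hθ.inv_mem_union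
  prod_mem w hw h := by
    obtain ⟨x, y, hx, hxy⟩ := hL.exists_path hw
    refine mem_union hx ?_
    induction w with
    | nil => exact hθ.one_mem hx
    | cons n w ih =>
      rw [prod_cons hw]
      obtain ⟨z, h1, h2⟩ := hxy
      obtain rfl := h1.unique (hθ.takes_of_mem_union hL (h n (by simp)) h1)
      exact hθ.mul_mem hx (hθ.mem_of_mem_union hL (h n (by simp)) hx h1)
        (ih (dom_tail hw) (fun g hg => h g (by simp [hg])) h2)
  conj_mem g n hn h := by
    obtain ⟨y, y', hy, x, h1, z, h2, -⟩ := hL.exists_path h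
    obtain rfl := h2.unique (hθ.takes_of_mem_union hL hn h2)
    have hx := (hL.orderOf_eq h1).symm.trans hy
    have h3 := h1.inv
    rw [PartialGroup.inv_inv] at h3
    exact mem_union hy ((hθ.conjTo hx h3).2 ▸ ⟨n, hθ.mem_of_mem_union hL hn hx h2, rfl⟩)
  inter_eq := by
    have := hL.finite
    refine Set.eq_singleton_iff_unique_mem.2 ⟨⟨hθ.one_mem_union hL, S.one_mem⟩, ?_⟩
    rintro u ⟨hu, huS⟩
    obtain ⟨a, ha, hu⟩ := mem_unionOf.1 hu
    exact congrArg (fun z : S => (z : L)) (hθ.eq_one hL.isPGroup ha (u := ⟨u, huS⟩) hu)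

/-! ### The signalizer functor on objects -/

theorem mem_onObjects (hθ : IsSignalizerFunctor p S θ) (hL : IsPuncturedGroup p Δ S)
    [Fact p.Prime] {P : Subgrp L} (hP : P ∈ Δ) {n : L} : n ∈ onObjects p θ P ↔
      n ∈ unionOf p S θ ∧ ∀ s ∈ S.toSubgroup P, Takes s n s := by
  have hPS := hL.subset hP
  constructor
  · rintro ⟨h1, h2⟩
    obtain ⟨x, hx, hxp⟩ := hL.exists_orderOf (hL.toSubgroup_ne_bot hP)
    refine ⟨mem_union hxp ?_, fun s hs => h2 s hs⟩
    exact Set.mem_iInter₂.1 h1 x ((mem_elemsOfOrder_iff hPS).2 ⟨hx, coe_mem_elemsOfOrder.2 hxp⟩)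
  · rintro ⟨h1, h2⟩
    refine ⟨Set.mem_iInter₂.2 fun x hx => ?_, fun s hs => h2 ⟨s, hPS hs⟩ hs⟩
    obtain ⟨hx, hxS, hxp⟩ := (mem_elemsOfOrder_iff hPS).1 hx
    exact hθ.mem_of_mem_union hL h1 hxp (h2 ⟨x, hxS⟩ hx)

theorem isSubgroup_onObjects (hθ : IsSignalizerFunctor p S θ) (hL : IsPuncturedGroup p Δ S)
    [Fact p.Prime] {P : Subgrp L} (hP : P ∈ Δ) : IsSubgroup (onObjects p θ P) := by
  obtain ⟨x, hx, hxp⟩ := hL.exists_orderOf (hL.toSubgroup_ne_bot hP)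
  have key : ∀ n ∈ onObjects p θ P, n ∈ θ (x : L) := fun n hn =>
    have h := (hθ.mem_onObjects hL hP).1 hn
    hθ.mem_of_mem_union hL h.1 hxp (h.2 x hx)
  refine Subgrp.isSubgroup_of_subset (hθ.subgrp hxp) key ?_ ?_ ?_
  · exact (hθ.mem_onObjects hL hP).2 ⟨hθ.one_mem_union hL, fun s _ => takes_one_right s⟩
  · intro m hm n hn
    refine (hθ.mem_onObjects hL hP).2
      ⟨mem_union hxp (hθ.mul_mem hxp (key m hm) (key n hn)), fun s hs => ?_⟩
    by_cases hs1 : s = 1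
    · subst hs1
      exact takes_one _
    · exact hL.comp hs1 (((hθ.mem_onObjects hL hP).1 hm).2 s hs)
        (((hθ.mem_onObjects hL hP).1 hn).2 s hs)
  · intro n hn
    have h := (hθ.mem_onObjects hL hP).1 hn
    exact (hθ.mem_onObjects hL hP).2 ⟨hθ.inv_mem_union h.1, fun s hs => (h.2 s hs).inv⟩

theorem conj_mem_onObjects (hθ : IsSignalizerFunctor p S θ) (hL : IsPuncturedGroup p Δ S)
    [Fact p.Prime] {P Q : Subgrp L} (hP : P ∈ Δ) (hQ : Q ∈ Δ) {g : L}
    (h : ConjTo (P : Set L) g (Q : Set L)) {n : L} (hn : n ∈ onObjects p θ P) :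
    n ∈ conjDom g ∧ conj g n ∈ onObjects p θ Q := by
  obtain ⟨hnN, hnP⟩ := (hθ.mem_onObjects hL hP).1 hn
  obtain ⟨x, hx, hxp⟩ := hL.exists_orderOf (hL.toSubgroup_ne_bot hP)
  have h1 : conj g (x : L) ∈ (Q : Set L) := h.2 ▸ ⟨x, hx, rfl⟩
  have hxy : Takes x g ⟨_, hL.subset hQ h1⟩ := ⟨h.1 hx, rfl⟩
  have hc := hθ.conjTo hxp hxy
  have hnx := hθ.mem_of_mem_union hL hnN hxp (hnP x hx)
  refine ⟨hc.1 hnx, (hθ.mem_onObjects hL hQ).2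
    ⟨mem_union ((hL.orderOf_eq hxy).symm.trans hxp) (hc.2 ▸ ⟨n, hnx, rfl⟩), ?_⟩⟩
  intro s hs
  by_cases hs1 : s = 1
  · subst hs1
    exact takes_one _
  have h2 : (s : L) ∈ conj g '' (P : Set L) := by
    rw [h.2]
    exact hs
  obtain ⟨s', hs', e⟩ := h2
  have h3 : Takes (⟨s', hL.subset hP hs'⟩ : S) g s := ⟨h.1 hs', e⟩
  exact hL.takes_prod hs1 ⟨_, h3.inv, _, hnP _ hs', _, h3, rfl⟩

theorem onObjects_conjTo (hθ : IsSignalizerFunctor p S θ) (hL : IsPuncturedGroup p Δ S)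
    [Fact p.Prime] {P Q : Subgrp L} (hP : P ∈ Δ) (hQ : Q ∈ Δ) {g : L}
    (h : ConjTo (P : Set L) g (Q : Set L)) : ConjTo (onObjects p θ P) g (onObjects p θ Q) := by
  refine ⟨fun n hn => (hθ.conj_mem_onObjects hL hP hQ h hn).1, Set.Subset.antisymm ?_ ?_⟩
  · rintro _ ⟨n, hn, rfl⟩
    exact (hθ.conj_mem_onObjects hL hP hQ h hn).2
  · intro n hn
    obtain ⟨h1, h2⟩ := hθ.conj_mem_onObjects hL hQ hP h.inv hn
    have := conj_inv_conj h1
    rw [PartialGroup.inv_inv] at this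
    exact ⟨_, h2, this⟩

theorem not_dvd_card_onObjects (hθ : IsSignalizerFunctor p S θ) (hL : IsPuncturedGroup p Δ S)
    [Fact p.Prime] {P : Subgrp L} (hP : P ∈ Δ) : ¬ p ∣ Nat.card (onObjects p θ P) := by
  have := hL.finite
  obtain ⟨x, hx, hxp⟩ := hL.exists_orderOf (hL.toSubgroup_ne_bot hP)
  have hle : onObjects p θ P ⊆ θ (x : L) := fun n hn =>
    have h := (hθ.mem_onObjects hL hP).1 hn
    hθ.mem_of_mem_union hL h.1 hxp (h.2 x hx)
  let K : Subgrp L := ⟨onObjects p θ P, hθ.isSubgroup_onObjects hL hP⟩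
  have hdvd : Nat.card K ∣ Nat.card (hθ.subgrp hxp) :=
    Subgroup.card_dvd_of_injective (Subgrp.inclusion (H := K) (K := hθ.subgrp hxp) hle)
      (Subgrp.inclusion_injective _)
  exact fun h => (hθ.normal x (coe_mem_elemsOfOrder.2 hxp)).not_dvd (h.trans hdvd)

theorem isSignalizerFunctorOnObjects (hθ : IsSignalizerFunctor p S θ)
    (hL : IsPuncturedGroup p Δ S) [Fact p.Prime] :
    IsSignalizerFunctorOnObjects p Δ (onObjects p θ) where
  normal P hP :=
    { isSubgroup := hθ.isSubgroup_onObjects hL hP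
      subset := fun _ hn => (hL.mem_normalizer (hL.subset hP)).2 fun s hs =>
        ⟨s, hs, ((hθ.mem_onObjects hL hP).1 hn).2 s hs⟩
      normal := fun _ hh _ hk _ => (hθ.conj_mem_onObjects hL hP hP hh hk).2
      not_dvd := hθ.not_dvd_card_onObjects hL hP }
  conjugacy P hP Q hQ g h := hθ.onObjects_conjTo hL hP hQ h
  balance P hP Q hQ h := by
    ext n
    rw [Set.mem_inter_iff, hθ.mem_onObjects hL hP, hθ.mem_onObjects hL hQ]
    constructor
    · rintro ⟨⟨h1, -⟩, h2⟩
      exact ⟨h1, fun s hs => h2 s hs⟩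
    · rintro ⟨h1, h2⟩
      exact ⟨⟨h1, fun s hs => h2 s (h hs)⟩, fun s hs => h2 ⟨s, hL.subset hQ hs⟩ hs⟩

theorem unionOf_eq (hθ : IsSignalizerFunctor p S θ) (hL : IsPuncturedGroup p Δ S)
    [Fact p.Prime] : unionOf p S θ = ⋃ P ∈ Δ, onObjects p θ P := by
  ext n
  simp only [Set.mem_iUnion, exists_prop]
  constructor
  · intro hn
    obtain ⟨a, ha, hna⟩ := mem_unionOf.1 hn
    have hP : S.ofSubgroup (Subgroup.zpowers a) ∈ Δ :=
      hL.ofSubgroup_mem (by simpa using ne_one_of_orderOf ha)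
    refine ⟨_, hP, (hθ.mem_onObjects hL hP).2 ⟨hn, fun s hs => ?_⟩⟩
    obtain ⟨_, hs⟩ := (Subgrp.mem_ofSubgroup _ _).1 hs
    exact (Subgroup.zpowers_le (H := hL.fix n)).2 (hθ.takes ha hna) hs
  · rintro ⟨P, hP, hn⟩
    exact ((hθ.mem_onObjects hL hP).1 hn).1

end IsSignalizerFunctor

end Union

/-! ### An application of Sylow's theorem -/

/-- If `K` is a normal `p'`-subgroup and `W` a `p`-subgroup of a finite group, then every
`p`-subgroup of `K W` is conjugate into `W` by an element of `K`, as `W` is a Sylow subgroup. -/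
theorem exists_conj_mem_of_mem_sup {G : Type*} [Group G] [Finite G] {p : ℕ} [Fact p.Prime]
    (K W A : Subgroup G) [K.Normal] (hK : ¬ p ∣ Nat.card K) (hW : IsPGroup p W)
    (hA : IsPGroup p A) : ∃ k ∈ K, ∀ a ∈ A, a ∈ K ⊔ W → k⁻¹ * a * k ∈ W := by
  have hdisj : K ⊓ W = ⊥ := by
    obtain ⟨n, hn⟩ := (hW.to_inf_right (H := K)).exists_card_eq
    have h1 : Nat.card (K ⊓ W : Subgroup G) ∣ Nat.card K := Subgroup.card_dvd_of_le inf_le_left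
    rcases n with - | n
    · exact Subgroup.card_eq_one.1 (by simpa using hn)
    · exact absurd (((dvd_pow_self p n.succ_ne_zero).trans hn.symm.dvd).trans h1) hK
  set H := K ⊔ W with hH
  have hidx : ¬ p ∣ (W.subgroupOf H).index := by
    have h1 : Nat.card K * K.relIndex H = Nat.card H := by
      rw [← Subgroup.relIndex_bot_left, Subgroup.relIndex_mul_relIndex _ _ _ bot_le le_sup_left,
        Subgroup.relIndex_bot_left]
    have h2 : Nat.card W * W.relIndex H = Nat.card H := by
      rw [← Subgroup.relIndex_bot_left, Subgroup.relIndex_mul_relIndex _ _ _ bot_le le_sup_right,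
        Subgroup.relIndex_bot_left]
    have h3 : K.relIndex H = Nat.card W := by
      rw [hH, sup_comm, Subgroup.relIndex_sup_right, ← Subgroup.inf_relIndex_right, hdisj,
        Subgroup.relIndex_bot_left]
    rw [h3, mul_comm, ← h2] at h1
    have h4 := Nat.eq_of_mul_eq_mul_left Nat.card_pos h1
    change ¬ p ∣ W.relIndex H
    rwa [← h4]
  let P : Sylow p H := (hW.comap_subtype (K := H)).toSylow hidx
  obtain ⟨P', hP'⟩ := (hA.comap_subtype (K := H)).exists_le_sylow
  obtain ⟨g, hg⟩ := MulAction.exists_smul_eq H P P'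
  obtain ⟨k, hk, w, hw, e⟩ := Subgroup.mem_sup_of_normal_left.1 g.2
  refine ⟨k, hk, fun a ha haH => ?_⟩
  have h1 : (⟨a, haH⟩ : H) ∈ P' := hP' (Subgroup.mem_comap.2 ha)
  rw [← hg, ← SetLike.mem_coe, Sylow.coe_smul, Set.mem_smul_set_iff_inv_smul_mem] at h1
  have h2 : (g : G)⁻¹ * a * g ∈ W := by
    simpa [P, Subgroup.mem_subgroupOf] using h1
  have h3 := W.mul_mem (W.mul_mem hw h2) (W.inv_mem hw)
  rw [← e] at h3
  convert h3 using 1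
  group

section Sylow

variable {L : Type*} [PartialGroup L] {p : ℕ} {Δ : Set (Subgrp L)} {S : Subgrp L} {θ : L → Set L}

theorem mem_toSubgroup_ofSubgroup {Q : Subgroup S} {x : S} :
    x ∈ S.toSubgroup (S.ofSubgroup Q) ↔ x ∈ Q := by
  rw [Subgrp.mem_toSubgroup, Subgrp.mem_ofSubgroup]
  exact ⟨fun ⟨_, h⟩ => h, fun h => ⟨x.2, h⟩⟩

theorem takes_of_mem_normalizer {Q : Subgroup S} {s : S}
    (hs : s ∈ Subgroup.normalizer (Q : Set S)) {x : S} (hx : x ∈ Q) :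
    ∃ y ∈ Q, Takes x (s : L) y := by
  refine ⟨_, ?_, takes_coe x s⟩
  simpa using (Subgroup.mem_normalizer_iff.1 ((Subgroup.normalizer _).inv_mem hs) x).1 hx

namespace IsSignalizerFunctor

/-- The elements of the union of the signalizers which centralize `Q`; for `Q ≠ 1` this is
`Θ(Q)`. -/
def centralizing (p : ℕ) (θ : L → Set L) (Q : Subgroup S) : Set L :=
  {n | n ∈ unionOf p S θ ∧ ∀ x ∈ Q, Takes x n x}

theorem onObjects_ofSubgroup (hθ : IsSignalizerFunctor p S θ) (hL : IsPuncturedGroup p Δ S)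
    [Fact p.Prime] {Q : Subgroup S} (hQ : Q ≠ ⊥) :
    onObjects p θ (S.ofSubgroup Q) = centralizing p θ Q := by
  ext n
  simp only [hθ.mem_onObjects hL (hL.ofSubgroup_mem hQ), mem_toSubgroup_ofSubgroup]
  rfl

theorem isSubgroup_centralizing (hθ : IsSignalizerFunctor p S θ) (hL : IsPuncturedGroup p Δ S)
    [Fact p.Prime] {Q : Subgroup S} (hQ : Q ≠ ⊥) :
    IsSubgroup (centralizing p θ Q) := by
  rw [← hθ.onObjects_ofSubgroup hL hQ]
  exact hθ.isSubgroup_onObjects hL (hL.ofSubgroup_mem hQ)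

theorem mul_mem_centralizing (hθ : IsSignalizerFunctor p S θ) (hL : IsPuncturedGroup p Δ S)
    [Fact p.Prime] {Q : Subgroup S} (hQ : Q ≠ ⊥) {m n : L} (hm : m ∈ centralizing p θ Q)
    (hn : n ∈ centralizing p θ Q) : m ⋆ n ∈ centralizing p θ Q :=
  (⟨_, hθ.isSubgroup_centralizing hL hQ⟩ : Subgrp L).pair_mem hm hn

theorem inv_mem_centralizing (hθ : IsSignalizerFunctor p S θ) {Q : Subgroup S} {n : L}
    (hn : n ∈ centralizing p θ Q) : n⁻¹ ∈ centralizing p θ Q :=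
  ⟨hθ.inv_mem_union hn.1, fun x hx => (hn.2 x hx).inv⟩

/-- Let `1 ≠ Q ≤ S_f`. Some `k ∈ Θ(Q)` has the property that `S_{kf}` contains every
`s ∈ N_S(Q)` with `s ^ f ∈ N S` for the union `N` of the signalizers. In the group `N_L(Q)`, the
`p`-group `W` of the elements conjugated into `S` by `f` is a Sylow subgroup of `Θ(Q) W`, and `k`
conjugates the group of the given elements `s` into `W`. -/
theorem exists_stab_mul (hθ : IsSignalizerFunctor p S θ) (hL : IsPuncturedGroup p Δ S)
    [Fact p.Prime] {Q : Subgroup S} (hQ : Q ≠ ⊥) {f : L} (hf : Q ≤ hL.stab f) :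
    ∃ k ∈ centralizing p θ Q, ∀ s ∈ Subgroup.normalizer (Q : Set S),
      ∀ m ∈ centralizing p θ Q, ∀ t : S, (s : L) ⋆ f = m ⋆ (f ⋆ (t : L)) →
        s ∈ hL.stab (k ⋆ f) := by
  have := hL.finite
  have hP := hL.ofSubgroup_mem hQ
  set M := hL.normalizerSubgrp hP with hM
  have memM : ∀ {g : L}, g ∈ M ↔ ∀ x ∈ Q, ∃ y ∈ Q, Takes x g y := by
    intro g
    rw [hM, hL.mem_normalizerSubgrp hP]
    simp only [mem_toSubgroup_ofSubgroup]
  have act : ∀ (g : M) (x : S), x ∈ Q → ∃ y ∈ Q, Takes x (g : L) y := fun g => memM.1 g.2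
  have actf : ∀ x ∈ Q, ∃ y, Takes x f y := hf
  obtain ⟨x, hx, hxp⟩ := hL.exists_orderOf hQ
  have hx1 := ne_one_of_orderOf hxp
  obtain ⟨y, hy⟩ := actf x hx
  -- `w f = f t` and `w' f = f t'` imply `w w' f = f t t'`
  have mulW : ∀ (w w' : M) (t t' : S), (w : L) ⋆ f = f ⋆ (t : L) → (w' : L) ⋆ f = f ⋆ (t' : L) →
      ((w * w' : M) : L) ⋆ f = f ⋆ ((t * t' : S) : L) := by
    intro w w' t t' h h'
    obtain ⟨x₁, hx₁, h1⟩ := act w x hx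
    obtain ⟨x₂, hx₂, h2⟩ := act w' x₁ hx₁
    obtain ⟨y₁, hy₁⟩ := actf x₁ hx₁
    obtain ⟨y₂, hy₂⟩ := actf x₂ hx₂
    rw [Subgrp.coe_mul, hL.assoc hx1 h1 h2 hy₂, h', ← hL.assoc hx1 h1 hy₁ (takes_coe _ _), h,
      hL.assoc hx1 hy (takes_coe _ _) (takes_coe _ _), Subgrp.coe_mul]
  have invW : ∀ (w : M) (t : S), (w : L) ⋆ f = f ⋆ (t : L) →
      ((w⁻¹ : M) : L) ⋆ f = f ⋆ ((t⁻¹ : S) : L) := by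
    intro w t h
    obtain ⟨x₁, hx₁, h1⟩ := act w⁻¹ x hx
    obtain ⟨y₁, hy₁⟩ := actf x₁ hx₁
    have e : (((w⁻¹ : M) : L) ⋆ f) ⋆ (t : L) = f := by
      rw [hL.assoc hx1 h1 hy₁ (takes_coe _ _), ← h, Subgrp.coe_inv]
      refine hL.inv_mul_cancel (g := (w : L)) (h1.ne_one hx1) ?_ hy
      simpa [PartialGroup.inv_inv] using h1.inv
    conv_rhs => rw [← e]
    rw [Subgrp.coe_inv S, hL.mul_inv_cancel_right hx1 (hL.comp hx1 h1 hy₁) (takes_coe _ _)]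
  have oneW : ((1 : M) : L) ⋆ f = f ⋆ ((1 : S) : L) := by
    rw [Subgrp.coe_one, Subgrp.coe_one, prod_one_left, prod_one_right]
  let W : Subgroup M :=
    { carrier := {w | ∃ t : S, (w : L) ⋆ f = f ⋆ (t : L)}
      one_mem' := ⟨1, oneW⟩
      mul_mem' := fun {w w'} ⟨t, h⟩ ⟨t', h'⟩ => ⟨t * t', mulW w w' t t' h h'⟩
      inv_mem' := fun {w} ⟨t, h⟩ => ⟨t⁻¹, invW w t h⟩ }
  have hW : IsPGroup p W := by
    rintro ⟨w, t, h⟩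
    have hpow : ∀ n : ℕ, ((w ^ n : M) : L) ⋆ f = f ⋆ ((t ^ n : S) : L) := by
      intro n
      induction n with
      | zero => simpa using oneW
      | succ n ih => rw [pow_succ, pow_succ]; exact mulW _ _ _ _ ih h
    obtain ⟨n, hn⟩ := hL.isPGroup t
    refine ⟨n, Subtype.ext (Subtype.ext ?_)⟩
    have h1 := hpow (p ^ n)
    rw [hn, ← oneW] at h1
    obtain ⟨x₁, hx₁, h2⟩ := act (w ^ p ^ n) x hx
    obtain ⟨y₁, hy₁⟩ := actf x₁ hx₁
    exact hL.cancel_right hx1 hx1 h2 hy₁ (takes_one_right x) hy h1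
  let A : Subgroup M := M.toSubgroup S
  have hA : IsPGroup p A := by
    rintro ⟨a, ha⟩
    have haS : (a : L) ∈ S := ha
    obtain ⟨n, hn⟩ := hL.isPGroup ⟨a, haS⟩
    refine ⟨n, Subtype.ext (Subtype.ext ?_)⟩
    have h1 := congrArg (fun z : S => (z : L)) hn
    rw [Subgrp.coe_pow_eq _ a.2] at h1
    exact h1
  have hKsub : onObjects p θ (S.ofSubgroup Q) = centralizing p θ Q :=
    hθ.onObjects_ofSubgroup hL hQ
  let K₀ : Subgrp L := ⟨centralizing p θ Q, hθ.isSubgroup_centralizing hL hQ⟩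
  have hK₀M : ∀ n ∈ centralizing p θ Q, n ∈ M := fun n hn =>
    memM.2 fun x hx => ⟨x, hx, hn.2 x hx⟩
  let K : Subgroup M := M.toSubgroup K₀
  have hKn : K.Normal := by
    refine ⟨fun n hn g => ?_⟩
    have h1 := hθ.conj_mem_onObjects hL hP hP (g := ((g⁻¹ : M) : L)) (g⁻¹).2 (n := (n : L))
      (hKsub ▸ hn)
    rw [hKsub] at h1
    have h2 : conj ((g⁻¹ : M) : L) (n : L) = ((g * n * g⁻¹ : M) : L) := by
      have hd : [((g⁻¹ : M) : L)⁻¹, (n : L), ((g⁻¹ : M) : L)] ∈ (D : Set (List L)) := h1.1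
      rw [conj, prod_cons hd, mul_assoc, Subgrp.coe_inv, PartialGroup.inv_inv]
      rfl
    have h3 := h1.2
    rw [h2] at h3
    exact h3
  have hKp : ¬ p ∣ Nat.card K := by
    have h1 := hθ.not_dvd_card_onObjects hL hP
    rw [hKsub] at h1
    rwa [Nat.card_congr (⟨fun n => ⟨n.1.1, n.2⟩, fun n => ⟨⟨n.1, hK₀M n.1 n.2⟩, n.2⟩,
      fun _ => rfl, fun _ => rfl⟩ : K ≃ centralizing p θ Q)]
  obtain ⟨k, hk, hkA⟩ := exists_conj_mem_of_mem_sup K W A hKp hW hA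
  refine ⟨k, hk, fun s hs m hm t e => ?_⟩
  have hsM : (s : L) ∈ M := memM.2 fun x hx => takes_of_mem_normalizer hs hx
  let s' : M := ⟨s, hsM⟩
  let m' : M := ⟨m, hK₀M m hm⟩
  have hfk : ∀ x ∈ Q, ∃ y, Takes x ((k : L) ⋆ f) y := by
    intro x hx
    by_cases hx1 : x = 1
    · subst hx1
      exact ⟨1, takes_one _⟩
    · obtain ⟨y, hy⟩ := actf x hx
      exact ⟨y, hL.comp hx1 (hk.2 x hx) hy⟩
  have hw : m'⁻¹ * s' ∈ W := by
    obtain ⟨x₁, hx₁, h1⟩ := act m'⁻¹ x hx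
    obtain ⟨x₂, hx₂, h2⟩ := act s' x₁ hx₁
    obtain ⟨y₂, hy₂⟩ := actf x₂ hx₂
    refine ⟨t, ?_⟩
    rw [Subgrp.coe_mul, hL.assoc hx1 h1 h2 hy₂]
    change ((m'⁻¹ : M) : L) ⋆ ((s : L) ⋆ f) = _
    rw [e]
    exact hL.inv_mul_cancel hx1 (hm.2 x hx) (hL.comp hx1 hy (takes_coe _ _))
  have hs'H : s' ∈ K ⊔ W := by
    have := Subgroup.mul_mem_sup (show m' ∈ K from hm) hw
    rwa [_root_.mul_inv_cancel_left] at this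
  obtain ⟨t', ht'⟩ := hkA s' s.2 hs'H
  obtain ⟨x₁, hx₁, h1⟩ := act (k⁻¹ * s' * k) x hx
  obtain ⟨y₁, hy₁⟩ := actf x₁ hx₁
  obtain ⟨x₂, hx₂, h2⟩ := takes_of_mem_normalizer hs hx
  obtain ⟨y₂, hy₂⟩ := hfk x₂ hx₂
  obtain ⟨y₃, hy₃⟩ := hfk x hx
  obtain ⟨y₄, hy₄⟩ := actf x₂ hx₂
  have e2 : (s : L) ⋆ ((k : L) ⋆ f) = ((k : L) ⋆ f) ⋆ (t' : L) := by
    rw [← hL.assoc hx1 h2 (hk.2 x₂ hx₂) hy₄, hL.assoc hx1 (hk.2 x hx) hy (takes_coe _ _), ← ht',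
      ← hL.assoc hx1 (hk.2 x hx) h1 hy₁]
    congr 2
    have : s' * k = k * (k⁻¹ * s' * k) := by group
    exact congrArg (fun z : M => (z : L)) this
  rw [(takes_coe x s).unique h2 |>.symm] at hy₂
  exact ⟨t', hL.takes_of_mul_eq hx1 hy₃ hy₂ e2⟩

end IsSignalizerFunctor

end Sylow

/-! ### Maximal elements and the splitting lemma -/

section Maximal

variable {L : Type*} [PartialGroup L] {p : ℕ} {Δ : Set (Subgrp L)} {S : Subgrp L} {θ : L → Set L}

/-- `g` lies below `f` with respect to `N` if `g = n f` for some `n ∈ N` which centralizes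
`S_g`, and `S_g ≤ S_f`. -/
def IsPuncturedGroup.Below (hL : IsPuncturedGroup p Δ S) (N : Set L) (g f : L) : Prop :=
  ∃ n ∈ N, g = n ⋆ f ∧ hL.stab g ≤ hL.fix n ∧ hL.stab g ≤ hL.stab f

/-- `f` is maximal if `S_h = S_f` for all `h` such that `f` lies below `h`. -/
def IsPuncturedGroup.IsMax (hL : IsPuncturedGroup p Δ S) (N : Set L) (f : L) : Prop :=
  ∀ h, hL.Below N f h → hL.stab h ≤ hL.stab f

theorem IsPuncturedGroup.stab_ne_bot (hL : IsPuncturedGroup p Δ S) [Fact p.Prime] (g : L) :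
    hL.stab g ≠ ⊥ := by
  obtain ⟨x, y, hx, z, h, -⟩ := hL.exists_path (singleton_mem g)
  intro e
  have h1 : x ∈ hL.stab g := ⟨z, h⟩
  rw [e, Subgroup.mem_bot] at h1
  exact ne_one_of_orderOf hx h1

namespace IsSignalizerFunctor

theorem below_refl (hθ : IsSignalizerFunctor p S θ) (hL : IsPuncturedGroup p Δ S)
    [Fact p.Prime] (g : L) : hL.Below (unionOf p S θ) g g :=
  ⟨one L, hθ.one_mem_union hL, (prod_one_left g).symm, fun x _ => takes_one_right x, le_rfl⟩

theorem below_trans (hθ : IsSignalizerFunctor p S θ) (hL : IsPuncturedGroup p Δ S)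
    [Fact p.Prime] {g f h : L} (h1 : hL.Below (unionOf p S θ) g f)
    (h2 : hL.Below (unionOf p S θ) f h) : hL.Below (unionOf p S θ) g h := by
  obtain ⟨n, hn, rfl, hfix, hle⟩ := h1
  obtain ⟨m, hm, rfl, hfix', hle'⟩ := h2
  obtain ⟨x, hx, hxp⟩ := hL.exists_orderOf (hL.stab_ne_bot (n ⋆ (m ⋆ h)))
  have hnm := hθ.mul_mem_centralizing hL (hL.stab_ne_bot (n ⋆ (m ⋆ h))) ⟨hn, hfix⟩
    ⟨hm, fun x hx => hfix' (hle hx)⟩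
  obtain ⟨y, hy⟩ := hle' (hle hx)
  exact ⟨n ⋆ m, hnm.1, (hL.assoc (ne_one_of_orderOf hxp) (hfix hx) (hfix' (hle hx)) hy).symm,
    hnm.2, hle.trans hle'⟩

/-- Every element lies below a maximal element. -/
theorem exists_isMax (hθ : IsSignalizerFunctor p S θ) (hL : IsPuncturedGroup p Δ S)
    [Fact p.Prime] (g : L) :
    ∃ f, hL.Below (unionOf p S θ) g f ∧ hL.IsMax (unionOf p S θ) f := by
  have := hL.finite
  obtain ⟨f, hf, hmax⟩ := Set.Finite.exists_maximalFor (fun f => Nat.card (hL.stab f))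
    {f | hL.Below (unionOf p S θ) g f} (Set.toFinite _) ⟨g, hθ.below_refl hL g⟩
  refine ⟨f, hf, fun h hh => ?_⟩
  have hle : hL.stab f ≤ hL.stab h := by
    obtain ⟨-, -, -, -, h1⟩ := hh
    exact h1
  exact (Subgroup.eq_of_le_of_card_ge hle
    (hmax (hθ.below_trans hL hf hh) (Subgroup.card_le_of_le hle))).ge

/-- If `n ∈ Θ(Q)`, then an element of `N_S(Q)` in `S_f ∩ S_{nf}` is centralized by `n`. -/
theorem takes_of_mem_stab (hθ : IsSignalizerFunctor p S θ) (hL : IsPuncturedGroup p Δ S)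
    [Fact p.Prime] {Q : Subgroup S} (hQ : Q ≠ ⊥) {f n : L} (hQf : Q ≤ hL.stab f)
    (hn : n ∈ centralizing p θ Q) {s : S} (hs : s ∈ Subgroup.normalizer (Q : Set S))
    (hsf : s ∈ hL.stab f) (hsnf : s ∈ hL.stab (n ⋆ f)) : Takes s n s := by
  obtain ⟨x, hx, hxp⟩ := hL.exists_orderOf hQ
  have hx1 := ne_one_of_orderOf hxp
  obtain ⟨x₂, hx₂, hxs⟩ := takes_of_mem_normalizer hs hx
  have hx₂e := (takes_coe x s).unique hxs
  obtain ⟨y, hy⟩ := hQf hx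
  obtain ⟨y₂, hy₂⟩ := hQf hx₂
  obtain ⟨r, hr⟩ := hsf
  obtain ⟨t, ht⟩ := hsnf
  have hy1 := hy.ne_one hx1
  have hyp : orderOf y = p := (hL.orderOf_eq hy).symm.trans hxp
  have hnx := hθ.mem_of_mem_union hL hn.1 hxp (hn.2 x hx)
  obtain ⟨m, hm, e⟩ := hθ.exists_mul_right hxp hy hnx
  have hmy := hθ.takes hyp hm
  have hry : Takes y (r : L) y₂ := by
    have h1 := hL.takes_mul (hL.takes_mul hr.inv_inv hy) hr
    rw [hx₂e] at h1
    have h2 := takes_coe y r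
    rwa [h1.unique hy₂] at h2
  have hmy₂ : Takes y₂ m y₂ := by
    have h1 := hL.comp (hry.ne_one hy1) hy₂.inv
      (hL.comp (hxs.ne_one hx1) (hn.2 x₂ hx₂) hy₂)
    rwa [e, hL.inv_mul_cancel hx1 hy hmy] at h1
  -- with `n f = f m`, `s ^ f = r` and `s ^ (n f) = t`, the element `m` conjugates `r` to `t`
  have e1 : (r : L) ⋆ m = m ⋆ (t : L) := by
    refine hL.cancel_left hx1 hy (hL.comp hy1 hry hmy₂) (hL.comp hy1 hmy (takes_coe _ _)) ?_
    rw [← hL.assoc hx1 hy hry hmy₂, ← hr.mul_eq, hL.assoc hx1 hxs hy₂ hmy₂, ← e, ht.mul_eq, e,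
      hL.assoc hx1 hy hmy (takes_coe _ _)]
  have hmt : Takes r m t := by
    refine hL.takes_of_mul_eq hy1 hmy (z := y₂) ?_ e1
    rwa [(takes_coe y r).unique hry]
  obtain rfl := (hθ.takes_of_mem_union hL (mem_union hyp hm) hmt).unique hmt
  refine hL.takes_of_mul_eq hx1 (hn.2 x hx) (z := x₂) ?_ ?_
  · rw [hx₂e]
    exact hn.2 x₂ hx₂
  · refine hL.cancel_right hx1 hx1 (hL.comp hx1 hxs (hn.2 x₂ hx₂)) hy₂
      (hL.comp hx1 (hn.2 x hx) hxs) hy₂ ?_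
    rw [hL.assoc hx1 hxs (hn.2 x₂ hx₂) hy₂, ht.mul_eq, hL.assoc hx1 (hn.2 x hx) hy (takes_coe _ _),
      hL.assoc hx1 (hn.2 x hx) hxs hy₂, hr.mul_eq]

/-- Splitting lemma: if `f` is maximal, then `S_{nf} = C_S(n) ∩ S_f` for all `n` in the union of
the signalizers for which `(n, f)` is in the domain of the product. -/
theorem stab_mul_le (hθ : IsSignalizerFunctor p S θ) (hL : IsPuncturedGroup p Δ S)
    [Fact p.Prime] {f : L} (hf : hL.IsMax (unionOf p S θ) f) {n : L} (hn : n ∈ unionOf p S θ)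
    (hd : [n, f] ∈ (D : Set (List L))) : hL.stab (n ⋆ f) ≤ hL.fix n ⊓ hL.stab f := by
  have := hL.finite
  obtain ⟨Q, hQdef⟩ : ∃ Q, Q = hL.fix n ⊓ hL.stab f := ⟨_, rfl⟩
  induction Q using WellFoundedGT.induction generalizing n with
  | ind Q ih =>
  rw [← hQdef]
  by_contra hnot
  have hQn : Q ≤ hL.fix n := hQdef ▸ inf_le_left
  have hQf : Q ≤ hL.stab f := hQdef ▸ inf_le_right
  have hQ : Q ≠ ⊥ := by
    obtain ⟨x, y, hx, hnx, hxy⟩ := hθ.exists_takes hL hn hd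
    intro e
    have h1 : x ∈ Q := by
      rw [hQdef]
      exact ⟨hθ.takes hx hnx, y, hxy⟩
    rw [e, Subgroup.mem_bot] at h1
    exact ne_one_of_orderOf hx h1
  have hnQ : n ∈ centralizing p θ Q := ⟨hn, hQn⟩
  have comp : ∀ {k : L}, k ∈ centralizing p θ Q → Q ≤ hL.stab (k ⋆ f) := by
    intro k hk x hx
    by_cases hx1 : x = 1
    · subst hx1
      exact Subgroup.one_mem _
    · obtain ⟨y, hy⟩ := hQf hx
      have h1 : Takes x (k ⋆ f) y := hL.comp hx1 (hk.2 x hx) hy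
      exact ⟨y, h1⟩
  obtain ⟨k, hk, hkstab⟩ := hθ.exists_stab_mul hL hQ hQf
  obtain ⟨s, ⟨t, ht⟩, hsQ, hsN⟩ := hL.exists_normalizing (comp hnQ) hnot
  obtain ⟨x, hx, hxp⟩ := hL.exists_orderOf hQ
  have hx1 := ne_one_of_orderOf hxp
  obtain ⟨y, hy⟩ := hQf hx
  obtain ⟨x₂, hx₂, hxs⟩ := takes_of_mem_normalizer hsN hx
  obtain ⟨y₂, hy₂⟩ := hQf hx₂
  have hskf : s ∈ hL.stab (k ⋆ f) := by
    -- moving `n ∈ Θ(Q)` to the left of `s ∈ N_S(Q)` turns `s (n f) = (n f) t` into the form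
    -- `s f = m (f t)` with `m ∈ Θ(Q)`
    have hP := hL.ofSubgroup_mem hQ
    have hsP : (s : L) ∈ normalizer (S.ofSubgroup Q : Set L) := by
      refine (hL.mem_normalizer (hL.subset hP)).2 ?_
      simp only [mem_toSubgroup_ofSubgroup]
      exact fun x hx => takes_of_mem_normalizer hsN hx
    have hc := hθ.onObjects_conjTo hL hP hP hsP
    rw [hθ.onObjects_ofSubgroup hL hQ] at hc
    obtain ⟨n', hn', rfl⟩ : n ∈ conj (s : L) '' centralizing p θ Q := hc.2.symm ▸ hnQ
    set n := conj (s : L) n'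
    have e : (s : L) ⋆ n = n' ⋆ (s : L) := mul_conj (hc.1 hn')
    refine hkstab s hsN (n'⁻¹ ⋆ n)
      (hθ.mul_mem_centralizing hL hQ (hθ.inv_mem_centralizing hn') hnQ) t ?_
    rw [hL.assoc hx1 (hn'.2 x hx).inv (hnQ.2 x hx) (hL.comp hx1 hy (takes_coe _ _)),
      ← hL.assoc hx1 (hnQ.2 x hx) hy (takes_coe _ _), ← ht.mul_eq,
      ← hL.assoc hx1 hxs (hnQ.2 x₂ hx₂) hy₂, e, hL.assoc hx1 (hn'.2 x hx) hxs hy₂,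
      hL.inv_mul_cancel hx1 (hn'.2 x hx) (hL.comp hx1 hxs hy₂)]
  by_cases hfQ : hL.stab f ≤ Q
  -- here `f` lies below `k f` and `S_{kf}` contains `s ∉ S_f`, against the maximality of `f`
  · have hb : hL.Below (unionOf p S θ) f (k ⋆ f) :=
      ⟨k⁻¹, hθ.inv_mem_union hk.1, (hL.inv_mul_cancel hx1 (hk.2 x hx) hy).symm,
        fun x hx => (hk.2 x (hfQ hx)).inv, hfQ.trans (comp hk)⟩
    exact hsQ (hfQ (hf _ hb hskf))
  -- here `C_S(k) ∩ S_f` is larger than `Q`, so the induction hypothesis applies to `k`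
  · obtain ⟨u, ⟨r, hr⟩, huQ, huN⟩ := hL.exists_normalizing hQf hfQ
    have hukf : u ∈ hL.stab (k ⋆ f) := by
      refine hkstab u huN (one L) ⟨hθ.one_mem_union hL, fun x _ => takes_one_right x⟩ r ?_
      rw [prod_one_left, hr.mul_eq]
    have huk : Takes u k u := hθ.takes_of_mem_stab hL hQ hQf hk huN ⟨r, hr⟩ hukf
    have hlt : Q < hL.fix k ⊓ hL.stab f :=
      lt_of_le_of_ne (le_inf hk.2 hQf) fun e => huQ (e ▸ ⟨huk, r, hr⟩)
    have h1 := ih _ hlt hk.1 (hL.comp_dom hx1 (hk.2 x hx) hy) rfl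
    have hsf := (h1 hskf).2
    refine hsQ (hQdef ▸ ⟨?_, hsf⟩)
    exact hθ.takes_of_mem_stab hL hQ hQf hnQ hsN hsf ⟨t, ht⟩

/-! ### Maximal cosets -/

theorem mem_coset_of_below (hL : IsPuncturedGroup p Δ S) [Fact p.Prime] {g f : L}
    (h : hL.Below (unionOf p S θ) g f) : g ∈ coset (unionOf p S θ) f := by
  obtain ⟨n, hn, e, hfix, hle⟩ := h
  obtain ⟨x, hx, hxp⟩ := hL.exists_orderOf (hL.stab_ne_bot g)
  obtain ⟨y, hy⟩ := hle hx
  exact ⟨n, hn, hL.comp_dom (ne_one_of_orderOf hxp) (hfix hx) hy, e.symm⟩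

theorem below_of_mem_coset (hθ : IsSignalizerFunctor p S θ) (hL : IsPuncturedGroup p Δ S)
    [Fact p.Prime] {g f : L} (hf : hL.IsMax (unionOf p S θ) f)
    (h : g ∈ coset (unionOf p S θ) f) : hL.Below (unionOf p S θ) g f := by
  obtain ⟨n, hn, hd, rfl⟩ := h
  have h1 := hθ.stab_mul_le hL hf hn hd
  exact ⟨n, hn, rfl, h1.trans inf_le_left, h1.trans inf_le_right⟩

theorem mem_coset_self (hθ : IsSignalizerFunctor p S θ) (hL : IsPuncturedGroup p Δ S)
    [Fact p.Prime] (g : L) : g ∈ coset (unionOf p S θ) g :=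
  mem_coset_of_below hL (hθ.below_refl hL g)

theorem coset_subset_of_below (hθ : IsSignalizerFunctor p S θ) (hL : IsPuncturedGroup p Δ S)
    [Fact p.Prime] {g f : L} (h : hL.Below (unionOf p S θ) g f) :
    coset (unionOf p S θ) g ⊆ coset (unionOf p S θ) f := by
  obtain ⟨n, hn, e, hfix, hle⟩ := h
  rintro _ ⟨m, hm, hd, rfl⟩
  obtain ⟨x, y, hx, hmx, hxy⟩ := hθ.exists_takes hL hm hd
  have hx1 := ne_one_of_orderOf hx
  have hnx : Takes x n x := hfix ⟨y, hxy⟩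
  obtain ⟨y', hy'⟩ := hle ⟨y, hxy⟩
  have hmn := hθ.mul_mem hx hmx (hθ.mem_of_mem_union hL hn hx hnx)
  refine ⟨m ⋆ n, mem_union hx hmn, hL.comp_dom hx1 (hθ.takes hx hmn) hy', ?_⟩
  rw [hL.assoc hx1 (hθ.takes hx hmx) hnx hy', e]

theorem coset_eq_of_mem (hθ : IsSignalizerFunctor p S θ) (hL : IsPuncturedGroup p Δ S)
    [Fact p.Prime] {g f f' : L} (hf : hL.IsMax (unionOf p S θ) f)
    (hf' : hL.IsMax (unionOf p S θ) f') (h : g ∈ coset (unionOf p S θ) f)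
    (h' : g ∈ coset (unionOf p S θ) f') : coset (unionOf p S θ) f = coset (unionOf p S θ) f' := by
  have key : ∀ {f f' : L}, hL.IsMax (unionOf p S θ) f → hL.IsMax (unionOf p S θ) f' →
      g ∈ coset (unionOf p S θ) f → g ∈ coset (unionOf p S θ) f' →
      coset (unionOf p S θ) f' ⊆ coset (unionOf p S θ) f := by
    intro f f' hf hf' h h'
    refine hθ.coset_subset_of_below hL (hθ.below_of_mem_coset hL hf ?_)
    obtain ⟨n, hn, e, hfix, hle⟩ := hθ.below_of_mem_coset hL hf h
    obtain ⟨n', hn', e', hfix', hle'⟩ := hθ.below_of_mem_coset hL hf' h'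
    obtain ⟨x, hx, hxp⟩ := hL.exists_orderOf (hL.stab_ne_bot g)
    have hx1 := ne_one_of_orderOf hxp
    obtain ⟨y, hy⟩ := hle hx
    obtain ⟨y', hy'⟩ := hle' hx
    have hm := hθ.mul_mem hxp (hθ.inv_mem hxp (hθ.mem_of_mem_union hL hn' hxp (hfix' hx)))
      (hθ.mem_of_mem_union hL hn hxp (hfix hx))
    refine ⟨n'⁻¹ ⋆ n, mem_union hxp hm, hL.comp_dom hx1 (hθ.takes hxp hm) hy, ?_⟩
    rw [hL.assoc hx1 (hfix' hx).inv (hfix hx) hy, ← e, e',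
      hL.inv_mul_cancel hx1 (hfix' hx) hy']
  exact Set.Subset.antisymm (key hf' hf h' h) (key hf hf' h h')

theorem maximal_coset (hθ : IsSignalizerFunctor p S θ) (hL : IsPuncturedGroup p Δ S)
    [Fact p.Prime] {f : L} (hf : hL.IsMax (unionOf p S θ) f) :
    Maximal (fun X : Set L => ∃ f : L, X = coset (unionOf p S θ) f) (coset (unionOf p S θ) f) := by
  refine ⟨⟨f, rfl⟩, ?_⟩
  rintro _ ⟨g, rfl⟩ hle
  obtain ⟨f', hgf', hf'⟩ := hθ.exists_isMax hL g
  have h1 := hθ.coset_subset_of_below hL hgf'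
  have h2 := hθ.mem_coset_self hL f
  rw [hθ.coset_eq_of_mem hL hf hf' h2 (h1 (hle h2))]
  exact h1

theorem exists_isMax_coset (hθ : IsSignalizerFunctor p S θ) (hL : IsPuncturedGroup p Δ S)
    [Fact p.Prime] (C : MaxCosets (unionOf p S θ)) :
    ∃ f, hL.IsMax (unionOf p S θ) f ∧ C.1 = coset (unionOf p S θ) f := by
  obtain ⟨C, ⟨g, rfl⟩, hmax⟩ := C
  obtain ⟨f, hgf, hf⟩ := hθ.exists_isMax hL g
  have h1 := hθ.coset_subset_of_below hL hgf
  exact ⟨f, hf, Set.Subset.antisymm h1 (hmax ⟨f, rfl⟩ h1)⟩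

/-- A maximal element of a given maximal coset. -/
noncomputable def sec (hθ : IsSignalizerFunctor p S θ) (hL : IsPuncturedGroup p Δ S)
    [Fact p.Prime] (C : MaxCosets (unionOf p S θ)) : L :=
  Classical.choose (hθ.exists_isMax_coset hL C)

theorem isMax_sec (hθ : IsSignalizerFunctor p S θ) (hL : IsPuncturedGroup p Δ S)
    [Fact p.Prime] (C : MaxCosets (unionOf p S θ)) : hL.IsMax (unionOf p S θ) (hθ.sec hL C) :=
  (Classical.choose_spec (hθ.exists_isMax_coset hL C)).1

theorem coset_sec (hθ : IsSignalizerFunctor p S θ) (hL : IsPuncturedGroup p Δ S)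
    [Fact p.Prime] (C : MaxCosets (unionOf p S θ)) :
    C.1 = coset (unionOf p S θ) (hθ.sec hL C) :=
  (Classical.choose_spec (hθ.exists_isMax_coset hL C)).2

/-- The natural map, which sends `g` to the maximal coset containing `g`. -/
noncomputable def toMaxCosets (hθ : IsSignalizerFunctor p S θ) (hL : IsPuncturedGroup p Δ S)
    [Fact p.Prime] (g : L) : MaxCosets (unionOf p S θ) :=
  ⟨coset (unionOf p S θ) (Classical.choose (hθ.exists_isMax hL g)),
    hθ.maximal_coset hL (Classical.choose_spec (hθ.exists_isMax hL g)).2⟩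

theorem isNaturalMap (hθ : IsSignalizerFunctor p S θ) (hL : IsPuncturedGroup p Δ S)
    [Fact p.Prime] : IsNaturalMap (unionOf p S θ) (hθ.toMaxCosets hL) := by
  intro g C
  have hg : g ∈ (hθ.toMaxCosets hL g).1 :=
    mem_coset_of_below hL (Classical.choose_spec (hθ.exists_isMax hL g)).1
  constructor
  · intro h
    refine Subtype.ext ?_
    rw [hθ.coset_sec hL C] at h
    rw [hθ.coset_sec hL (hθ.toMaxCosets hL g)] at hg
    rw [hθ.coset_sec hL C, hθ.coset_sec hL (hθ.toMaxCosets hL g)]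
    exact hθ.coset_eq_of_mem hL (hθ.isMax_sec hL _) (hθ.isMax_sec hL _) h hg
  · rintro rfl
    exact hg

theorem toMaxCosets_sec (hθ : IsSignalizerFunctor p S θ) (hL : IsPuncturedGroup p Δ S)
    [Fact p.Prime] (C : MaxCosets (unionOf p S θ)) : hθ.toMaxCosets hL (hθ.sec hL C) = C := by
  refine ((hθ.isNaturalMap hL _ C).1 ?_).symm
  rw [hθ.coset_sec hL C]
  exact hθ.mem_coset_self hL _

theorem toMaxCosets_val (hθ : IsSignalizerFunctor p S θ) (hL : IsPuncturedGroup p Δ S)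
    [Fact p.Prime] {f : L} (hf : hL.IsMax (unionOf p S θ) f) :
    (hθ.toMaxCosets hL f).1 = coset (unionOf p S θ) f := by
  have h := (hθ.isNaturalMap hL f ⟨_, hθ.maximal_coset hL hf⟩).1 (hθ.mem_coset_self hL f)
  rw [← h]

theorem below_of_eq (hθ : IsSignalizerFunctor p S θ) (hL : IsPuncturedGroup p Δ S)
    [Fact p.Prime] {g f : L} (hf : hL.IsMax (unionOf p S θ) f)
    (h : hθ.toMaxCosets hL g = hθ.toMaxCosets hL f) : hL.Below (unionOf p S θ) g f := by
  refine hθ.below_of_mem_coset hL hf ?_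
  rw [← hθ.toMaxCosets_val hL hf]
  exact (hθ.isNaturalMap hL g _).2 h.symm

theorem toMaxCosets_mul (hθ : IsSignalizerFunctor p S θ) (hL : IsPuncturedGroup p Δ S)
    [Fact p.Prime] {n g : L} (hn : n ∈ unionOf p S θ) (hd : [n, g] ∈ (D : Set (List L))) :
    hθ.toMaxCosets hL (n ⋆ g) = hθ.toMaxCosets hL g := by
  obtain ⟨f, hgf, hf⟩ := hθ.exists_isMax hL g
  have h1 : n ⋆ g ∈ coset (unionOf p S θ) f :=
    hθ.coset_subset_of_below hL hgf ⟨n, hn, hd, rfl⟩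
  have h2 := mem_coset_of_below hL hgf
  rw [← hθ.toMaxCosets_val hL hf] at h1 h2
  rw [← (hθ.isNaturalMap hL _ _).1 h1, ← (hθ.isNaturalMap hL _ _).1 h2]

end IsSignalizerFunctor

end Maximal

/-! ### Quotients of partial groups -/

section Quotients

variable {L L' : Type*}

/-- The partial group structure on `L'` induced by a map `ρ : L → L'` with a section `σ` such that
`σ ∘ ρ` preserves the domain `D` and, up to `ρ`, the product and the inversion. A word in `L'` is
in the domain if its image under `σ` is. -/
@[reducible] def ofSection [PartialGroup L] (ρ : L → L') (σ : L' → L) (hσ : ∀ c, ρ (σ c) = c)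
    (h1 : ∀ w : List L, w ∈ (D : Set (List L)) → (w.map ρ).map σ ∈ (D : Set (List L)))
    (h2 : ∀ w : List L, w ∈ (D : Set (List L)) → ρ (prod ((w.map ρ).map σ)) = ρ (prod w))
    (h3 : ∀ g, ρ (σ (ρ g))⁻¹ = ρ g⁻¹) : PartialGroup L' where
  inv c := ρ (σ c)⁻¹
  nonempty := (PartialGroup.nonempty (L := L)).map ρ
  D := {w | w.map σ ∈ (D : Set (List L))}
  prod w := ρ (prod (w.map σ))
  inv_inv c := by
    rw [h3, PartialGroup.inv_inv, hσ]
  singleton_mem c := singleton_mem (σ c)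
  append_mem u v h := by
    simp only [Set.mem_ofPred_eq, List.map_append] at h
    exact append_mem _ _ h
  prod_singleton c := by
    rw [List.map_singleton, prod_singleton, hσ]
  contract_mem u v w h := by
    simp only [Set.mem_ofPred_eq, List.map_append] at h
    have := h1 _ (contract_mem _ _ _ h)
    have e : ρ ∘ σ = id := funext hσ
    simpa [e] using this
  prod_contract u v w h := by
    simp only [Set.mem_ofPred_eq, List.map_append] at h
    have e : ρ ∘ σ = id := funext hσ
    have := h2 _ (contract_mem _ _ _ h)
    rw [← prod_contract _ _ _ h] at this
    simpa [e] using this.symm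
  inv_append_mem w h := by
    have e : ρ ∘ σ = id := funext hσ
    simpa [e, Function.comp_def] using h1 _ (inv_append_mem _ h)
  prod_inv_append w h := by
    have e : ρ ∘ σ = id := funext hσ
    have := h2 _ (inv_append_mem _ h)
    rw [prod_inv_append _ h] at this
    simpa [e, Function.comp_def] using this

variable [PartialGroup L] [PartialGroup L']

theorem Hom.map_one (ρ : Hom L L') : ρ (one L) = one L' := ρ.map_prod [] nil_mem

theorem Hom.map_mul (ρ : Hom L L') {a b : L} (h : [a, b] ∈ (D : Set (List L))) :
    ρ (a ⋆ b) = ρ a ⋆ ρ b := ρ.map_prod _ h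

theorem Hom.map_conj (ρ : Hom L L') {g x : L} (h : x ∈ conjDom g) :
    ρ x ∈ conjDom (ρ g) ∧ conj (ρ g) (ρ x) = ρ (conj g x) := by
  have h1 := ρ.map_dom _ h
  have h2 := ρ.map_prod _ h
  simp only [List.map_cons, List.map_nil, ρ.map_inv] at h1 h2
  exact ⟨h1, h2.symm⟩

theorem ConjTo.map (ρ : Hom L L') {P Q : Subgrp L} {g : L}
    (h : ConjTo (P : Set L) g (Q : Set L)) :
    ConjTo (P.map ρ : Set L') (ρ g) (Q.map ρ : Set L') := by
  refine ⟨?_, ?_⟩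
  · rintro _ ⟨x, hx, rfl⟩
    exact (ρ.map_conj (h.1 hx)).1
  · change _ '' (ρ.toFun '' (P : Set L)) = ρ.toFun '' (Q : Set L)
    rw [← h.2, Set.image_image, Set.image_image]
    exact Set.image_congr fun x hx => (ρ.map_conj (h.1 hx)).2

/-- The restriction of a homomorphism of partial groups to a subgroup. -/
def Subgrp.mapHom (ρ : Hom L L') (H : Subgrp L) : H →* H.map ρ where
  toFun x := ⟨ρ x, x, x.2, rfl⟩
  map_one' := Subtype.ext ρ.map_one
  map_mul' x y := Subtype.ext (ρ.map_mul (H.pair_dom x.2 y.2))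

theorem Subgrp.mapHom_surjective (ρ : Hom L L') (H : Subgrp L) :
    Function.Surjective (H.mapHom ρ) := by
  rintro ⟨_, x, hx, rfl⟩
  exact ⟨⟨x, hx⟩, rfl⟩

theorem Hom.IsProjection.surjective {ρ : Hom L L'} (hρ : ρ.IsProjection) (y : L') :
    ∃ x, ρ x = y := by
  have h1 : [y] ∈ List.map ρ.toFun '' (D : Set (List L)) := hρ ▸ singleton_mem y
  obtain ⟨w, -, hw⟩ := h1
  match w, hw with
  | [x], h => exact ⟨x, List.singleton_injective h⟩

end Quotients

/-! ### Conjugation of elements of `S` in the quotient -/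

section QuotientMap

variable {L L' : Type*} [PartialGroup L] [PartialGroup L'] {p : ℕ} {Δ : Set (Subgrp L)}
  {S : Subgrp L} {θ : L → Set L}

/-- The properties of the natural map `L → L / N` from which its remaining properties follow:
`ρ` is a projection, its fibres contain maximal elements, and all elements of a fibre lie below
each of its maximal elements. -/
structure IsPuncturedGroup.IsQuotientMap (hL : IsPuncturedGroup p Δ S) (N : Set L)
    (ρ : Hom L L') : Prop where
  isProjection : ρ.IsProjection
  exists_isMax : ∀ g, ∃ f, hL.IsMax N f ∧ ρ f = ρ g
  below_of_eq : ∀ f g, hL.IsMax N f → ρ g = ρ f → hL.Below N g f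
  map_eq_one : ∀ n ∈ N, ρ n = one L'

namespace IsPuncturedGroup

theorem stab_coe (hL : IsPuncturedGroup p Δ S) (s : S) : hL.stab (s : L) = ⊤ :=
  eq_top_iff.2 fun x _ => ⟨_, takes_coe x s⟩

theorem isMax_coe (hL : IsPuncturedGroup p Δ S) (N : Set L) (s : S) : hL.IsMax N (s : L) :=
  fun h _ => by
    rw [hL.stab_coe]
    exact le_top

theorem mul_coe_mul_inv (hL : IsPuncturedGroup p Δ S) [Fact p.Prime] (f : L) (t : S) :
    (f ⋆ (t : L)) ⋆ ((t⁻¹ : S) : L) = f := by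
  obtain ⟨x, ⟨y, hy⟩, hxp⟩ := hL.exists_orderOf (hL.stab_ne_bot f)
  exact hL.mul_inv_cancel_right (ne_one_of_orderOf hxp) hy (takes_coe y t)

theorem stab_mul_coe (hL : IsPuncturedGroup p Δ S) [Fact p.Prime] (f : L) (t : S) :
    hL.stab (f ⋆ (t : L)) = hL.stab f := by
  have key : ∀ (f : L) (t : S), hL.stab f ≤ hL.stab (f ⋆ (t : L)) := by
    rintro f t x ⟨y, hy⟩
    by_cases hx1 : x = 1
    · subst hx1
      exact one_mem _
    · have h1 := hL.comp hx1 hy (takes_coe y t)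
      exact ⟨_, h1⟩
  refine le_antisymm ?_ (key f t)
  have := key (f ⋆ (t : L)) t⁻¹
  rwa [hL.mul_coe_mul_inv] at this

theorem isMax_mul_coe (hL : IsPuncturedGroup p Δ S) [Fact p.Prime] {N : Set L} {f : L}
    (hf : hL.IsMax N f) (t : S) : hL.IsMax N (f ⋆ (t : L)) := by
  rintro h ⟨n, hn, e, hfix, hle⟩
  rw [hL.stab_mul_coe] at hfix hle ⊢
  rw [← hL.stab_mul_coe h t⁻¹]
  refine hf _ ⟨n, hn, ?_, hfix, by rwa [hL.stab_mul_coe]⟩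
  obtain ⟨x, hx, hxp⟩ := hL.exists_orderOf (hL.stab_ne_bot f)
  obtain ⟨y, hy⟩ := hle hx
  rw [← hL.assoc (ne_one_of_orderOf hxp) (hfix hx) hy (takes_coe y t⁻¹), ← e,
    hL.mul_coe_mul_inv]

theorem Below.takes {hL : IsPuncturedGroup p Δ S} {N : Set L} {g f : L} (h : hL.Below N g f)
    {x y : S} (hxy : Takes x g y) : Takes x f y := by
  obtain ⟨n, -, e, hfix, hle⟩ := h
  obtain ⟨y', hy'⟩ := hle ⟨y, hxy⟩
  by_cases hx1 : x = 1
  · subst hx1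
    obtain rfl := hxy.unique (takes_one g)
    exact takes_one f
  · have h1 := hL.comp hx1 (hfix ⟨y, hxy⟩) hy'
    rw [← e] at h1
    rwa [hxy.unique h1]

end IsPuncturedGroup

namespace IsSignalizerFunctor

/-- If `f` is maximal, then every element `s` of `S` whose image is conjugated by `ρ f` into the
image of `S` lies in `S_f`. The splitting lemma, applied to `s f` and the maximal element `f t`,
shows that `s` normalizes `S_f`, and then Sylow's theorem yields an element `h` above `f` such
that `S_h` contains both `S_f` and `s`. -/
theorem takes_of_map (hθ : IsSignalizerFunctor p S θ) (hL : IsPuncturedGroup p Δ S)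
    [Fact p.Prime] {ρ : Hom L L'} (hρ : hL.IsQuotientMap (unionOf p S θ) ρ) {f : L}
    (hf : hL.IsMax (unionOf p S θ) f) {s t : S} (hd : ρ (s : L) ∈ conjDom (ρ f))
    (he : conj (ρ f) (ρ (s : L)) = ρ (t : L)) : s ∈ hL.stab f := by
  have := hL.finite
  -- lift the word `(ρ f)⁻¹, ρ s, ρ f` to `L`; as `f` and `s` are maximal, a path for
  -- the lift is also one for `f⁻¹, s, f`
  have hd' : [(ρ f)⁻¹, ρ (s : L), ρ f] ∈ List.map ρ.toFun '' (D : Set (List L)) :=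
    hρ.isProjection ▸ hd
  obtain ⟨v, hv, e⟩ := hd'
  obtain ⟨a, v, rfl, ea, e⟩ := List.map_eq_cons_iff.1 e
  obtain ⟨b, v, rfl, eb, e⟩ := List.map_eq_cons_iff.1 e
  obtain ⟨c, v, rfl, ec, e⟩ := List.map_eq_cons_iff.1 e
  obtain rfl := List.map_eq_nil_iff.1 e
  obtain ⟨x₀, x₃, hx₀, x₁, ha, x₂, hb, z, hc, -⟩ := hL.exists_path hv
  have hf₂ : Takes x₂ f z := (hρ.below_of_eq _ _ hf ec).takes hc
  have hs₁ : Takes x₁ (s : L) x₂ := (hρ.below_of_eq _ _ (hL.isMax_coe _ s) eb).takes hb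
  have hf₁ : Takes x₁ f x₀ := by
    refine (hρ.below_of_eq f a⁻¹ hf ?_).takes ha.inv
    rw [ρ.map_inv]
    rw [ea, PartialGroup.inv_inv]
  have hx₁p : orderOf x₁ = p := (hL.orderOf_eq hf₁).trans hx₀
  have hx₁ := ne_one_of_orderOf hx₁p
  have hx₀1 := ne_one_of_orderOf hx₀
  have hpath : Path x₀ [f⁻¹, (s : L), f] z := ⟨x₁, hf₁.inv, x₂, hs₁, z, hf₂, rfl⟩
  have hdom : (s : L) ∈ conjDom f := hL.dom_of_path hx₀1 hpath
  have hg : Takes x₀ (conj f (s : L)) z := hL.takes_prod hx₀1 hpath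
  have hρg : ρ (conj f (s : L)) = ρ (t : L) := by rw [← he, (ρ.map_conj hdom).2]
  obtain ⟨n, hn, en, hfix, -⟩ := hρ.below_of_eq _ _ (hL.isMax_coe _ t) hρg
  have hn₀ : Takes x₀ n x₀ := hfix ⟨z, hg⟩
  obtain ⟨m, hm, em⟩ := hθ.exists_mul_left hx₁p hf₁ (hθ.mem_of_mem_union hL hn hx₀ hn₀)
  have hm₁ := hθ.takes hx₁p hm
  have esf : (s : L) ⋆ f = m ⋆ (f ⋆ (t : L)) := by
    rw [← mul_conj hdom, en, ← hL.assoc hx₁ hf₁ hn₀ (takes_coe _ _), ← em,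
      hL.assoc hx₁ hm₁ hf₁ (takes_coe _ _)]
  have hsplit := hθ.stab_mul_le hL (hL.isMax_mul_coe hf t) (mem_union hx₁p hm)
    (hL.comp_dom hx₁ hm₁ (hL.comp hx₁ hf₁ (takes_coe _ _)))
  rw [← esf, hL.stab_mul_coe] at hsplit
  have hconj : ∀ u ∈ hL.stab f, s * u * s⁻¹ ∈ hL.stab ((s : L) ⋆ f) := by
    rintro u ⟨v, hv⟩
    by_cases hu : u = 1
    · subst hu
      simp
    · have h1 : Takes (s * u * s⁻¹) (s : L) u := by
        have := takes_coe (s * u * s⁻¹) s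
        simpa [mul_assoc] using this
      have h2 := hL.comp (by simpa [mul_inv_eq_one] using hu) h1 hv
      exact ⟨v, h2⟩
  have hsN : s ∈ Subgroup.normalizer (hL.stab f : Set S) :=
    Subgroup.mem_normalizer_fintype fun u hu => (hsplit (hconj u hu)).2
  have hmQ : m ∈ centralizing p θ (hL.stab f) := by
    refine ⟨mem_union hx₁p hm, fun u hu => ?_⟩
    obtain ⟨v, hv, huv⟩ := takes_of_mem_normalizer hsN hu
    have h1 := hconj _ hv
    rw [← (takes_coe u s).unique huv] at h1
    have h2 : s * (s⁻¹ * u * s) * s⁻¹ = u := by group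
    rw [h2] at h1
    exact (hsplit h1).1
  obtain ⟨k, hk, hstab⟩ := hθ.exists_stab_mul hL (hL.stab_ne_bot f) le_rfl
  have hskf := hstab s hsN m hmQ t esf
  refine hf _ ⟨k⁻¹, hθ.inv_mem_union hk.1, ?_, fun x hx => (hk.2 x hx).inv, ?_⟩ hskf
  · exact (hL.inv_mul_cancel hx₁ (hk.2 x₁ ⟨x₀, hf₁⟩) hf₁).symm
  · rintro x ⟨y, hy⟩
    by_cases hx1 : x = 1
    · subst hx1
      exact Subgroup.one_mem _
    · have h1 := hL.comp hx1 (hk.2 x ⟨y, hy⟩) hy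
      exact ⟨y, h1⟩

theorem map_injOn (hθ : IsSignalizerFunctor p S θ) (hL : IsPuncturedGroup p Δ S)
    [Fact p.Prime] {ρ : Hom L L'} (hρ : hL.IsQuotientMap (unionOf p S θ) ρ) {s t : S}
    (h : ρ (s : L) = ρ (t : L)) : s = t := by
  have hN := hθ.isPartialNormalPPrime hL
  obtain ⟨x, hx, hxp⟩ := hL.exists_orderOf (hL.stab_ne_bot (s : L))
  obtain ⟨m, hm, e, hfix, -⟩ := hρ.below_of_eq _ _ (hL.isMax_coe _ t) h
  have h3 : m = ((s * t⁻¹ : S) : L) := by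
    rw [Subgrp.coe_mul, e, Subgrp.coe_inv]
    exact (hL.mul_inv_cancel_right (ne_one_of_orderOf hxp) (hfix hx) (takes_coe x t)).symm
  have h4 : m ∈ unionOf p S θ ∩ (S : Set L) := ⟨hm, h3 ▸ (s * t⁻¹).2⟩
  rw [hN.inter_eq] at h4
  have h5 : s * t⁻¹ = 1 := Subtype.ext (h3.symm.trans h4)
  exact mul_inv_eq_one.1 h5

theorem takes_iff_map (hθ : IsSignalizerFunctor p S θ) (hL : IsPuncturedGroup p Δ S)
    [Fact p.Prime] {ρ : Hom L L'} (hρ : hL.IsQuotientMap (unionOf p S θ) ρ) {f : L}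
    (hf : hL.IsMax (unionOf p S θ) f) {s t : S} : Takes s f t ↔
      ρ (s : L) ∈ conjDom (ρ f) ∧ conj (ρ f) (ρ (s : L)) = ρ (t : L) := by
  constructor
  · intro h
    rw [← h.2]
    exact ρ.map_conj h.1
  · rintro ⟨h1, h2⟩
    obtain ⟨t', ht'⟩ := hθ.takes_of_map hL hρ hf h1 h2
    have h3 := (ρ.map_conj ht'.1).2
    rw [ht'.2, h2] at h3
    rwa [hθ.map_injOn hL hρ h3]

end IsSignalizerFunctor

end QuotientMap

/-! ### The partial group of maximal cosets -/

section MaximalCosets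

variable {L : Type*} [PartialGroup L] {p : ℕ} {Δ : Set (Subgrp L)} {S : Subgrp L} {θ : L → Set L}

namespace IsSignalizerFunctor

theorem below_sec (hθ : IsSignalizerFunctor p S θ) (hL : IsPuncturedGroup p Δ S)
    [Fact p.Prime] (g : L) :
    hL.Below (unionOf p S θ) g (hθ.sec hL (hθ.toMaxCosets hL g)) :=
  hθ.below_of_eq hL (hθ.isMax_sec hL _) (hθ.toMaxCosets_sec hL _).symm

theorem path_sec (hθ : IsSignalizerFunctor p S θ) (hL : IsPuncturedGroup p Δ S)
    [Fact p.Prime] {w : List L} {x y : S} (h : Path x w y) :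
    Path x ((w.map (hθ.toMaxCosets hL)).map (hθ.sec hL)) y := by
  induction w generalizing x with
  | nil => exact h
  | cons g w ih =>
    obtain ⟨z, h1, h2⟩ := h
    exact ⟨z, (hθ.below_sec hL g).takes h1, ih h2⟩

/-- Replacing the letters of a word by maximal elements above them changes the product by a left
factor in the union of the signalizers. -/
theorem exists_prod_eq (hθ : IsSignalizerFunctor p S θ) (hL : IsPuncturedGroup p Δ S)
    [Fact p.Prime] {w : List L} {x y : S} (hx : orderOf x = p) (h : Path x w y) :
    ∃ m ∈ θ (x : L),
      prod w = m ⋆ prod ((w.map (hθ.toMaxCosets hL)).map (hθ.sec hL)) := by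
  induction w generalizing x with
  | nil => exact ⟨one L, hθ.one_mem hx, (prod_one_left _).symm⟩
  | cons g w ih =>
    have hx1 := ne_one_of_orderOf hx
    have hd := hL.dom_of_path hx1 h
    have hd' := hL.dom_of_path hx1 (hθ.path_sec hL h)
    obtain ⟨z, h1, h2⟩ := h
    have hb := hθ.below_sec hL g
    have hf := hb.takes h1
    obtain ⟨n, hn, e, hfix, -⟩ := hb
    have hnx : Takes x n x := hfix ⟨z, h1⟩
    have hz := (hL.orderOf_eq h1).symm.trans hx
    obtain ⟨m, hm, em⟩ := ih hz h2
    have hmz := hθ.takes hz hm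
    obtain ⟨m', hm', em'⟩ := hθ.exists_mul_left hx hf hm
    have hm'x := hθ.takes hx hm'
    have hw := hL.takes_prod (ne_one_of_orderOf hz) (hθ.path_sec hL h2)
    refine ⟨n ⋆ m', hθ.mul_mem hx (hθ.mem_of_mem_union hL hn hx hnx) hm', ?_⟩
    rw [prod_cons hd, em]
    simp only [List.map_cons] at hd' ⊢
    rw [prod_cons hd']
    conv_lhs => rw [e]
    rw [hL.assoc hx1 hnx hf (hL.comp (ne_one_of_orderOf hz) hmz hw),
      ← hL.assoc hx1 hf hmz hw, ← em', hL.assoc hx1 hm'x hf hw,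
      hL.assoc hx1 hnx hm'x (hL.comp hx1 hf hw)]

theorem toMaxCosets_inv (hθ : IsSignalizerFunctor p S θ) (hL : IsPuncturedGroup p Δ S)
    [Fact p.Prime] (g : L) : hθ.toMaxCosets hL (hθ.sec hL (hθ.toMaxCosets hL g))⁻¹ =
      hθ.toMaxCosets hL g⁻¹ := by
  have hb := hθ.below_sec hL g
  set f := hθ.sec hL (hθ.toMaxCosets hL g)
  obtain ⟨x, ⟨y, hxy⟩, hx⟩ := hL.exists_orderOf (hL.stab_ne_bot g)
  have hf := hb.takes hxy
  obtain ⟨n, hn, e, hfix, -⟩ := hb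
  have hx1 := ne_one_of_orderOf hx
  have hnx : Takes x n x := hfix ⟨y, hxy⟩
  have hy := (hL.orderOf_eq hxy).symm.trans hx
  obtain ⟨m, hm, em⟩ := hθ.exists_mul_left hy hf.inv
    (hθ.inv_mem hx (hθ.mem_of_mem_union hL hn hx hnx))
  rw [e, mul_inv_rev' (hL.comp_dom hx1 hnx hf), ← em, hθ.toMaxCosets_mul hL (mem_union hy hm)
    (hL.comp_dom (ne_one_of_orderOf hy) (hθ.takes hy hm) hf.inv)]

/-- The partial group `L / N` for the union `N` of the signalizers. -/
@[reducible] noncomputable def quotient (hθ : IsSignalizerFunctor p S θ)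
    (hL : IsPuncturedGroup p Δ S) [Fact p.Prime] : PartialGroup (MaxCosets (unionOf p S θ)) :=
  ofSection (hθ.toMaxCosets hL) (hθ.sec hL) (hθ.toMaxCosets_sec hL)
    (fun w hw => by
      obtain ⟨x, y, hx, h⟩ := hL.exists_path hw
      exact hL.dom_of_path (ne_one_of_orderOf hx) (hθ.path_sec hL h))
    (fun w hw => by
      obtain ⟨x, y, hx, h⟩ := hL.exists_path hw
      have hx1 := ne_one_of_orderOf hx
      obtain ⟨m, hm, e⟩ := hθ.exists_prod_eq hL hx h
      rw [e, hθ.toMaxCosets_mul hL (mem_union hx hm)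
        (hL.comp_dom hx1 (hθ.takes hx hm) (hL.takes_prod hx1 (hθ.path_sec hL h)))])
    (hθ.toMaxCosets_inv hL)

/-- The natural map as a homomorphism of partial groups. -/
@[reducible] noncomputable def proj (hθ : IsSignalizerFunctor p S θ)
    (hL : IsPuncturedGroup p Δ S) [Fact p.Prime] :
    @Hom L (MaxCosets (unionOf p S θ)) _ (hθ.quotient hL) :=
  letI := hθ.quotient hL
  { toFun := hθ.toMaxCosets hL
    map_dom := fun w hw => by
      obtain ⟨x, y, hx, h⟩ := hL.exists_path hw
      exact hL.dom_of_path (ne_one_of_orderOf hx) (hθ.path_sec hL h)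
    map_prod := fun w hw => by
      obtain ⟨x, y, hx, h⟩ := hL.exists_path hw
      have hx1 := ne_one_of_orderOf hx
      obtain ⟨m, hm, e⟩ := hθ.exists_prod_eq hL hx h
      rw [e, hθ.toMaxCosets_mul hL (mem_union hx hm)
        (hL.comp_dom hx1 (hθ.takes hx hm) (hL.takes_prod hx1 (hθ.path_sec hL h)))]
      rfl }

theorem isQuotientMap_proj (hθ : IsSignalizerFunctor p S θ) (hL : IsPuncturedGroup p Δ S)
    [Fact p.Prime] :
    letI := hθ.quotient hL
    hL.IsQuotientMap (unionOf p S θ) (hθ.proj hL) := by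
  let := hθ.quotient hL
  refine ⟨?_, fun g => ⟨_, hθ.isMax_sec hL (hθ.toMaxCosets hL g), hθ.toMaxCosets_sec hL _⟩,
    fun f g hf h => hθ.below_of_eq hL hf h, fun n hn => ?_⟩
  · refine Set.Subset.antisymm ?_ fun w hw => ⟨w.map (hθ.sec hL), hw, ?_⟩
    · rintro _ ⟨w, hw, rfl⟩
      exact (hθ.proj hL).map_dom w hw
    · have e : hθ.toMaxCosets hL ∘ hθ.sec hL = id := funext (hθ.toMaxCosets_sec hL)
      simp [e]
  · have h1 := hθ.toMaxCosets_mul hL hn (one_dom_right n)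
    rw [prod_one_right] at h1
    exact h1.trans (hθ.proj hL).map_one

end IsSignalizerFunctor

end MaximalCosets

/-! ### Fusion systems transported along an isomorphism -/

section Fusion

variable {S S' : Type*} [Group S] [Group S']

namespace FusionSystem

/-- The homomorphism `e⁻¹ φ e : e(P) → e(Q)`. -/
@[reducible] def transport (e : S ≃* S') {P Q : Subgroup S} (φ : P →* Q) :
    P.map e.toMonoidHom →* Q.map e.toMonoidHom :=
  ((e.subgroupMap Q).toMonoidHom.comp φ).comp (e.subgroupMap P).symm.toMonoidHom

theorem transport_apply (e : S ≃* S') {P Q : Subgroup S} (φ : P →* Q) (x : P)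
    (y : P.map e.toMonoidHom) (h : (y : S') = e x) : (transport e φ y : S') = e (φ x) := by
  have h1 : (e.subgroupMap P).symm y = x :=
    (MulEquiv.symm_apply_eq (e.subgroupMap P)).2 (Subtype.ext h)
  change ((e.subgroupMap Q) (φ ((e.subgroupMap P).symm y)) : S') = _
  rw [h1]
  rfl

theorem transport_injective_iff (e : S ≃* S') {P Q : Subgroup S} (φ : P →* Q) :
    Function.Injective (transport e φ) ↔ Function.Injective φ := by
  constructor
  · intro h x y hxy
    refine (e.subgroupMap P).injective (h (Subtype.ext ?_))
    refine (transport_apply e φ x _ rfl).trans ?_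
    rw [hxy]
    exact (transport_apply e φ y _ rfl).symm
  · intro h
    exact (e.subgroupMap Q).injective.comp (h.comp (e.subgroupMap P).symm.injective)

theorem mem_congr {X : ∀ P Q : Subgroup S, Set (P →* Q)} {P P' Q Q' : Subgroup S} (hP : P = P')
    (hQ : Q = Q') {φ : P →* Q} {ψ : P' →* Q'}
    (h : ∀ (x : S) (hx : x ∈ P) (hx' : x ∈ P'), (φ ⟨x, hx⟩ : S) = ψ ⟨x, hx'⟩) :
    φ ∈ X P Q ↔ ψ ∈ X P' Q' := by
  subst hP hQ
  have : φ = ψ := MonoidHom.ext fun x => Subtype.ext (h x x.2 x.2)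
  rw [this]

/-- The fusion system over `S` corresponding to a fusion system over `S'`. -/
def pull (e : S ≃* S') (F : FusionSystem S') : FusionSystem S where
  Hom P Q := {φ | transport e φ ∈ F.Hom (P.map e.toMonoidHom) (Q.map e.toMonoidHom)}
  injective P Q φ h := (transport_injective_iff e φ).1 (F.injective _ _ _ h)
  conj_mem P Q φ h := by
    obtain ⟨s, hs⟩ := h
    refine F.conj_mem _ _ _ ⟨e s, ?_⟩
    rintro ⟨_, x, hx, rfl⟩
    refine (transport_apply e φ ⟨x, hx⟩ _ rfl).trans ?_
    rw [hs]
    simp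
  comp_mem P Q R φ ψ h1 h2 := by
    have h3 := F.comp_mem _ _ _ _ _ h1 h2
    refine (mem_congr rfl rfl ?_).1 h3
    rintro _ ⟨x, hx, rfl⟩ h
    have e1 := transport_apply e φ ⟨x, hx⟩ ⟨_, h⟩ rfl
    exact (transport_apply e ψ _ _ e1).trans (transport_apply e (ψ.comp φ) ⟨x, hx⟩ _ rfl).symm
  iso_mem P Q φ h R ψ hψ := by
    have h1 := F.iso_mem _ _ _ h (R.map e.toMonoidHom)
      (((e.subgroupMap P).symm.trans ψ).trans (e.subgroupMap R)) (by
        rintro ⟨_, x, hx, rfl⟩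
        refine Eq.trans ?_ (transport_apply e φ ⟨x, hx⟩ _ rfl).symm
        refine (transport_apply e ψ.toMonoidHom ⟨x, hx⟩ _ rfl).trans ?_
        exact congrArg e (hψ ⟨x, hx⟩))
    exact h1

theorem identifies_generate (e : S ≃* S') {X : ∀ P Q : Subgroup S, Set (P →* Q)}
    {X' : ∀ P Q : Subgroup S', Set (P →* Q)}
    (h : ∀ (P Q : Subgroup S) (φ : P →* Q), φ ∈ X P Q ↔
      transport e φ ∈ X' (P.map e.toMonoidHom) (Q.map e.toMonoidHom)) :
    Identifies e (generate X) (generate X') := by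
  have map_map : ∀ P : Subgroup S, (P.map e.toMonoidHom).map e.symm.toMonoidHom = P := by
    intro P
    rw [Subgroup.map_map]
    convert Subgroup.map_id P
    ext x
    simp
  have map_map' : ∀ P : Subgroup S', (P.map e.symm.toMonoidHom).map e.toMonoidHom = P := by
    intro P
    rw [Subgroup.map_map]
    convert Subgroup.map_id P
    ext x
    simp
  intro P Q φ
  constructor
  · rintro ⟨h1, h2⟩
    refine ⟨(transport_injective_iff e φ).2 h1, fun F hF => ?_⟩
    exact h2 (pull e F) fun A B α hα => hF _ _ ((h A B α).1 hα)
  · rintro ⟨h1, h2⟩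
    refine ⟨(transport_injective_iff e φ).1 h1, fun F hF => ?_⟩
    have h3 : transport e.symm (transport e φ) ∈ F.Hom _ _ :=
      h2 (pull e.symm F) fun A B α hα => hF _ _ ((h _ _ _).2 ?_)
    · refine (mem_congr (map_map P) (map_map Q) ?_).1 h3
      intro x hx hx'
      have e1 := transport_apply e φ ⟨x, hx'⟩ ⟨e x, x, hx', rfl⟩ rfl
      have e2 := transport_apply e.symm (transport e φ) ⟨e x, x, hx', rfl⟩ ⟨x, hx⟩ (e.symm_apply_apply x).symm
      rw [e2, e1, MulEquiv.symm_apply_apply]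
    · refine (mem_congr (map_map' A) (map_map' B) ?_).2 hα
      intro x hx hx'
      have e1 := transport_apply e.symm α ⟨x, hx'⟩ ⟨e.symm x, x, hx', rfl⟩ rfl
      have e2 := transport_apply e (transport e.symm α) ⟨e.symm x, x, hx', rfl⟩ ⟨x, hx⟩ (e.apply_symm_apply x).symm
      rw [e2, e1, MulEquiv.apply_symm_apply]

end FusionSystem

end Fusion

/-! ### The quotient is a locality -/

section QuotientLocality

variable {L L' : Type*} [PartialGroup L] [PartialGroup L'] {p : ℕ} {Δ : Set (Subgrp L)}
  {S : Subgrp L} {θ : L → Set L}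

theorem Via.map {ρ : Hom L L'} {P : Subgrp L} {w : List L} (h : Via Δ P w) :
    Via (Subgrp.map ρ '' Δ) (P.map ρ) (w.map ρ.toFun) := by
  induction w generalizing P with
  | nil => trivial
  | cons g w ih =>
    obtain ⟨Q, hQ, h1, h2⟩ := h
    exact ⟨_, ⟨Q, hQ, rfl⟩, h1.map ρ, ih h2⟩

namespace IsSignalizerFunctor

theorem conjTo_of_map (hθ : IsSignalizerFunctor p S θ) (hL : IsPuncturedGroup p Δ S)
    [Fact p.Prime] {ρ : Hom L L'} (hρ : hL.IsQuotientMap (unionOf p S θ) ρ) {f : L}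
    (hf : hL.IsMax (unionOf p S θ) f) {P Q : Subgrp L} (hP : P ∈ Δ) (hQ : Q ∈ Δ)
    (h : ConjTo (P.map ρ : Set L') (ρ f) (Q.map ρ : Set L')) :
    ConjTo (P : Set L) f (Q : Set L) := by
  have hPS := hL.subset hP
  have hQS := hL.subset hQ
  have key : ∀ x ∈ P, ∃ y ∈ Q, x ∈ conjDom f ∧ conj f x = y := by
    intro x hx
    have h1 : conj (ρ f) (ρ x) ∈ (Q.map ρ : Set L') := h.2 ▸ ⟨_, ⟨x, hx, rfl⟩, rfl⟩
    obtain ⟨y, hy, e⟩ := h1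
    exact ⟨y, hy, (hθ.takes_iff_map hL hρ hf (s := ⟨x, hPS hx⟩) (t := ⟨y, hQS hy⟩)).2
      ⟨h.1 ⟨x, hx, rfl⟩, e.symm⟩⟩
  refine ⟨fun x hx => let ⟨_, _, h1, _⟩ := key x hx; h1, Set.Subset.antisymm ?_ ?_⟩
  · rintro _ ⟨x, hx, rfl⟩
    obtain ⟨y, hy, -, e⟩ := key x hx
    exact e ▸ hy
  · intro y hy
    have h1 : ρ y ∈ conj (ρ f) '' (P.map ρ : Set L') := by
      rw [h.2]
      exact ⟨y, hy, rfl⟩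
    obtain ⟨_, ⟨x, hx, rfl⟩, e⟩ := h1
    exact ⟨x, hx, ((hθ.takes_iff_map hL hρ hf (s := ⟨x, hPS hx⟩) (t := ⟨y, hQS hy⟩)).2
      ⟨h.1 ⟨x, hx, rfl⟩, e⟩).2⟩

/-- The isomorphism from `S` to its image. -/
noncomputable def equivMap (hθ : IsSignalizerFunctor p S θ) (hL : IsPuncturedGroup p Δ S)
    [Fact p.Prime] {ρ : Hom L L'} (hρ : hL.IsQuotientMap (unionOf p S θ) ρ) : S ≃* S.map ρ :=
  MulEquiv.ofBijective (S.mapHom ρ)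
    ⟨fun _ _ h => hθ.map_injOn hL hρ (congrArg (fun z : S.map ρ => (z : L')) h),
      S.mapHom_surjective ρ⟩

theorem mem_union_of_map_eq_one (hL : IsPuncturedGroup p Δ S)
    {ρ : Hom L L'} (hρ : hL.IsQuotientMap (unionOf p S θ) ρ) {g : L}
    (h : ρ g = one L') : g ∈ unionOf p S θ := by
  obtain ⟨n, hn, e, -⟩ := hρ.below_of_eq _ g (hL.isMax_coe _ 1) (h.trans ρ.map_one.symm)
  rw [Subgrp.coe_one, prod_one_right] at e
  rwa [e]

theorem self_mem (hL : IsPuncturedGroup p Δ S) : S ∈ Δ := by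
  obtain ⟨P, hP⟩ := hL.objects_nonempty
  exact hL.overgroup_mem P hP S (hL.subset hP) subset_rfl

/-- The image of `S` is a maximal `p`-subgroup. Otherwise its normalizer contains the image of
some `f ∈ N_L(S)` such that this image is a `p`-element outside the image of `S`. Then a power
`f ^ (p ^ k)` lies in a `p'`-group `θ(x)` of some order `q`, so `f ^ q` is a `p`-element of
`N_L(S)` and thus lies in the maximal `p`-subgroup `S`; as `q` is prime to `p`, the image of `f`
lies in that of `S`. -/
theorem map_eq_of_isPGroup (hθ : IsSignalizerFunctor p S θ) (hL : IsPuncturedGroup p Δ S)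
    [Fact p.Prime] {ρ : Hom L L'} (hρ : hL.IsQuotientMap (unionOf p S θ) ρ) {R : Subgrp L'}
    (hR : IsPGroup p R) (hSR : (S.map ρ : Set L') ⊆ R) : R = S.map ρ := by
  have := hL.finite
  have : Finite L' := Finite.of_surjective ρ.toFun hρ.isProjection.surjective
  set T : Subgroup R := R.toSubgroup (S.map ρ) with hT
  suffices hT : T = ⊤ by
    refine SetLike.ext fun r => ⟨fun hr => ?_, fun hr => hSR hr⟩
    have h1 : (⟨r, hr⟩ : R) ∈ T := hT ▸ Subgroup.mem_top _
    exact h1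
  by_contra hne
  have : Group.IsNilpotent R := hR.isNilpotent
  obtain ⟨r, hrN, hrT⟩ := SetLike.exists_of_lt
    (Group.normalizerCondition_of_isNilpotent T (lt_top_iff_ne_top.2 hne))
  obtain ⟨g, hg⟩ := hρ.isProjection.surjective (r : L')
  obtain ⟨f, hf, hfg⟩ := hρ.exists_isMax g
  have hfr : ρ f = r := hfg.trans hg
  have hfS : ∀ s : S, ∃ t, Takes s f t := by
    intro s
    let s' : R := ⟨ρ (s : L), hSR ⟨s, s.2, rfl⟩⟩
    have hs' : s' ∈ T := ⟨s, s.2, rfl⟩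
    have h1 : r⁻¹ * s' * r ∈ T := by
      simpa using (Subgroup.mem_normalizer_iff.1 ((Subgroup.normalizer _).inv_mem hrN) s').1 hs'
    obtain ⟨t, ht, e⟩ := h1
    have h2 := takes_coe s' r
    refine ⟨⟨t, ht⟩, (hθ.takes_iff_map hL hρ hf).2 ?_⟩
    rw [hfr]
    exact ⟨h2.1, h2.2.trans e.symm⟩
  set M := hL.normalizerSubgrp (self_mem hL) with hM
  have memM : ∀ {g : L}, g ∈ M ↔ ∀ s : S, ∃ t : S, Takes s g t := by
    intro g
    rw [hM, hL.mem_normalizerSubgrp]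
    exact ⟨fun h s => let ⟨t, _, h1⟩ := h s s.2; ⟨t, h1⟩,
      fun h s _ => let ⟨t, h1⟩ := h s; ⟨t, t.2, h1⟩⟩
  let f' : M := ⟨f, memM.2 hfS⟩
  have hSM : (S : Set L) ⊆ M := fun s hs => memM.2 fun x => ⟨_, takes_coe x ⟨s, hs⟩⟩
  let A : Subgroup M := M.toSubgroup S
  have hA : IsPGroup p A := by
    rintro ⟨a, ha⟩
    have haS : (a : L) ∈ S := ha
    obtain ⟨n, hn⟩ := hL.isPGroup ⟨a, haS⟩
    refine ⟨n, Subtype.ext (Subtype.ext ?_)⟩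
    have h1 := congrArg (fun z : S => (z : L)) hn
    rw [Subgrp.coe_pow_eq _ a.2] at h1
    exact h1
  have hAn : A.Normal := by
    refine ⟨fun a ha g => ?_⟩
    obtain ⟨b, hb⟩ := memM.1 (g⁻¹).2 ⟨a, ha⟩
    have h1 := takes_coe a g⁻¹
    rw [_root_.inv_inv] at h1
    have h2 : ((g * a * g⁻¹ : M) : L) = b := h1.2.symm.trans hb.2
    exact (h2 ▸ b.2 : ((g * a * g⁻¹ : M) : L) ∈ S)
  have hpow : ∀ n : ℕ, ρ ((f' ^ n : M) : L) = ((r ^ n : R) : L') := by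
    intro n
    have h1 : M.mapHom ρ f' = ⟨r, f, f'.2, hfr⟩ := Subtype.ext hfr
    have h2 : (M.mapHom ρ (f' ^ n) : L') = ρ ((f' ^ n : M) : L) := rfl
    rw [← h2, _root_.map_pow, h1]
    exact Subgrp.coe_pow_eq (H := M.map ρ) (K := R) ⟨f, f'.2, hfr⟩ r.2 n
  obtain ⟨k, hk⟩ := hR r
  have hcN : ((f' ^ p ^ k : M) : L) ∈ unionOf p S θ :=
    mem_union_of_map_eq_one hL hρ (by rw [hpow, hk]; rfl)
  obtain ⟨x, hx, hcx⟩ := mem_unionOf.1 hcN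
  set q := Nat.card (hθ.subgrp hx) with hq
  have hpq : p.Coprime q := by
    rw [(Fact.out : p.Prime).coprime_iff_not_dvd]
    exact (hθ.normal x (coe_mem_elemsOfOrder.2 hx)).not_dvd
  have hcq : (f' ^ p ^ k) ^ q = 1 := by
    refine Subtype.ext ?_
    have hcx' : ((f' ^ p ^ k : M) : L) ∈ hθ.subgrp hx := hcx
    have h1 : (⟨_, hcx'⟩ : hθ.subgrp hx) ^ q = 1 := pow_card_eq_one'
    have h2 := congrArg (fun z : hθ.subgrp hx => (z : L)) h1
    exact (Subgrp.coe_pow_eq (f' ^ p ^ k).2 hcx' q).trans h2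
  have hfq : IsPGroup p (Subgroup.zpowers (f' ^ q)) := by
    refine IsPGroup.of_card_dvd_pow (n := k) ?_
    rw [Nat.card_zpowers, orderOf_dvd_iff_pow_eq_one, ← pow_mul, mul_comm, pow_mul, hcq]
  have hsup : M.ofSubgroup (A ⊔ Subgroup.zpowers (f' ^ q)) = S := by
    refine hL.maximal _ (Subgrp.isPGroup_ofSubgroup _ _ (hA.to_sup_of_normal_left hfq)) ?_
    exact fun s hs => ⟨⟨s, hSM hs⟩, Subgroup.mem_sup_left hs, rfl⟩
  have hfqS : ((f' ^ q : M) : L) ∈ S := by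
    rw [← hsup]
    exact ⟨f' ^ q, Subgroup.mem_sup_right (Subgroup.mem_zpowers _), rfl⟩
  have hrq : r ^ q ∈ T := by
    refine ⟨_, hfqS, ?_⟩
    exact hpow q
  have hcop : q.Coprime (orderOf r) :=
    (hpq.symm.pow_right k).coprime_dvd_right (orderOf_dvd_of_pow_eq_one hk)
  exact hrT ((Subgroup.zpowers_le.2 hrq) (mem_zpowers_pow_iff.2 hcop))

theorem isLocality_map (hθ : IsSignalizerFunctor p S θ) (hL : IsPuncturedGroup p Δ S)
    [Fact p.Prime] {ρ : Hom L L'} (hρ : hL.IsQuotientMap (unionOf p S θ) ρ) :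
    IsLocality p (Subgrp.map ρ '' Δ) (S.map ρ) where
  finite :=
    have := hL.finite
    Finite.of_surjective ρ.toFun hρ.isProjection.surjective
  isPGroup := hL.isPGroup.of_surjective _ (S.mapHom_surjective ρ)
  objects_nonempty := hL.objects_nonempty.image _
  objects_le := by
    rintro _ ⟨P, hP, rfl⟩
    exact Set.image_mono (hL.subset hP)
  maximal R hR hSR := hθ.map_eq_of_isPGroup hL hρ hR hSR
  mem_dom_iff w := by
    constructor
    · intro hw
      rw [← hρ.isProjection] at hw
      obtain ⟨v, hv, rfl⟩ := hw
      obtain ⟨P, hP, h⟩ := (hL.mem_dom_iff v).1 hv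
      exact ⟨_, ⟨P, hP, rfl⟩, h.map⟩
    · rintro ⟨_, ⟨P, hP, rfl⟩, h⟩
      suffices h1 : ∃ v, v.map ρ.toFun = w ∧ Via Δ P v by
        obtain ⟨v, rfl, hv⟩ := h1
        exact ρ.map_dom v (hL.dom_of_via hP hv)
      induction w generalizing P with
      | nil => exact ⟨[], rfl, trivial⟩
      | cons g' w ih =>
        obtain ⟨_, ⟨Q, hQ, rfl⟩, h1, h2⟩ := h
        obtain ⟨v, rfl, hv⟩ := ih Q hQ h2
        obtain ⟨g, rfl⟩ := hρ.isProjection.surjective g'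
        obtain ⟨f, hf, e⟩ := hρ.exists_isMax g
        rw [← e] at h1 ⊢
        exact ⟨f :: v, rfl, Q, hQ, hθ.conjTo_of_map hL hρ hf hP hQ h1, hv⟩
  overgroup_mem := by
    rintro _ ⟨P, hP, rfl⟩ R hPR hRS
    let Q : Subgroup S := ((S.map ρ).toSubgroup R).comap (S.mapHom ρ)
    refine ⟨S.ofSubgroup Q, hL.overgroup_mem P hP _ (fun x hx => ?_) (S.ofSubgroup_subset Q), ?_⟩
    · exact ⟨⟨x, hL.subset hP hx⟩, hPR ⟨x, hx, rfl⟩, rfl⟩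
    · refine SetLike.ext fun r => ⟨?_, fun hr => ?_⟩
      · rintro ⟨_, ⟨x, hx, rfl⟩, rfl⟩
        exact hx
      · obtain ⟨x, hx, rfl⟩ := hRS hr
        exact ⟨x, ⟨⟨x, hx⟩, hr, rfl⟩, rfl⟩
  conj_mem := by
    rintro _ ⟨P, hP, rfl⟩ g' h
    obtain ⟨g, rfl⟩ := hρ.isProjection.surjective g'
    obtain ⟨f, hf, e⟩ := hρ.exists_isMax g
    rw [← e] at h ⊢
    obtain ⟨Q, hQ, hPQ⟩ := hL.conj_mem P hP f fun x hx => by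
      obtain ⟨-, h1, t, ht, e1⟩ := h ⟨x, hx, rfl⟩
      have h2 := (hθ.takes_iff_map hL hρ hf (s := ⟨x, hL.subset hP hx⟩) (t := ⟨t, ht⟩)).2
        ⟨h1, e1.symm⟩
      refine ⟨hL.subset hP hx, h2.1, ?_⟩
      have h3 : conj f x = t := h2.2
      rw [h3]
      exact ht
    exact ⟨_, ⟨Q, hQ, rfl⟩, hPQ.map ρ⟩

theorem identifies_fusionSystem (hθ : IsSignalizerFunctor p S θ) (hL : IsPuncturedGroup p Δ S)
    [Fact p.Prime] {ρ : Hom L L'} (hρ : hL.IsQuotientMap (unionOf p S θ) ρ) (e : S ≃* S.map ρ)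
    (he : ∀ s : S, (e s : L') = ρ (s : L)) :
    FusionSystem.Identifies e (fusionSystem Δ S)
      (fusionSystem (Subgrp.map ρ '' Δ) (S.map ρ)) := by
  refine FusionSystem.identifies_generate e fun A B φ => ?_
  constructor
  · rintro ⟨⟨P, hP, hPA⟩, g, hg⟩
    refine ⟨⟨_, ⟨P, hP, rfl⟩, ?_⟩, ρ g, ?_⟩
    · change ρ.toFun '' (P : Set L) = _
      rw [hPA]
      ext z
      constructor
      · rintro ⟨_, ⟨x, hx, rfl⟩, rfl⟩
        exact ⟨e x, ⟨x, hx, rfl⟩, he x⟩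
      · rintro ⟨_, ⟨x, hx, rfl⟩, rfl⟩
        exact ⟨x, ⟨x, hx, rfl⟩, (he x).symm⟩
    · rintro ⟨_, x, hx, rfl⟩
      have h1 := FusionSystem.transport_apply e φ ⟨x, hx⟩ ⟨_, x, hx, rfl⟩ rfl
      obtain ⟨h2, h3⟩ := hg ⟨x, hx⟩
      obtain ⟨h4, h5⟩ := ρ.map_conj h2
      refine ⟨(he x).symm ▸ h4, ?_⟩
      refine (congrArg (fun z : S.map ρ => (z : L')) h1).trans ?_
      change (e (φ ⟨x, hx⟩) : L') = conj (ρ g) (e x : L')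
      rw [he, he, h3, h5]
  · rintro ⟨⟨_, ⟨P, hP, rfl⟩, hPA⟩, g', hg⟩
    obtain ⟨g, rfl⟩ := hρ.isProjection.surjective g'
    obtain ⟨f, hf, ef⟩ := hρ.exists_isMax g
    rw [← ef] at hg
    refine ⟨⟨P, hP, Set.Subset.antisymm ?_ ?_⟩, f, fun x => ?_⟩
    · intro x hx
      have h1 : ρ x ∈ (P.map ρ : Set L') := ⟨x, hx, rfl⟩
      rw [hPA] at h1
      obtain ⟨_, ⟨y, hy, rfl⟩, e1⟩ := h1
      have h2 := hθ.map_injOn hL hρ (s := y) (t := ⟨x, hL.subset hP hx⟩) ((he y).symm.trans e1)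
      exact ⟨y, hy, congrArg (fun z : S => (z : L)) h2⟩
    · rintro _ ⟨x, hx, rfl⟩
      have h1 : ρ (x : L) ∈ (P.map ρ : Set L') := by
        rw [hPA]
        exact ⟨e x, ⟨x, hx, rfl⟩, he x⟩
      obtain ⟨y, hy, e1⟩ := h1
      have h2 := hθ.map_injOn hL hρ (s := ⟨y, hL.subset hP hy⟩) (t := x) e1
      have h3 : y = x := congrArg (fun z : S => (z : L)) h2
      change (x : L) ∈ P
      rw [← h3]
      exact hy
    · have h1 := FusionSystem.transport_apply e φ x ⟨_, x, x.2, rfl⟩ rfl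
      obtain ⟨h2, h3⟩ := hg ⟨_, x, x.2, rfl⟩
      replace h1 := congrArg (fun z : S.map ρ => (z : L')) h1
      have h4 : (e (φ x) : L') = conj (ρ f) (e x : L') := h1.symm.trans h3
      replace h2 : (e x : L') ∈ conjDom (ρ f) := h2
      rw [he, he] at h4
      rw [he] at h2
      have h5 := (hθ.takes_iff_map hL hρ hf).2 ⟨h2, h4.symm⟩
      exact ⟨h5.1, h5.2.symm⟩

theorem map_normalizer (hθ : IsSignalizerFunctor p S θ) (hL : IsPuncturedGroup p Δ S)
    [Fact p.Prime] {ρ : Hom L L'} (hρ : hL.IsQuotientMap (unionOf p S θ) ρ) {P : Subgrp L}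
    (hP : P ∈ Δ) : ((hL.normalizerSubgrp hP).map ρ : Set L') = normalizer (P.map ρ : Set L') := by
  refine Set.Subset.antisymm ?_ fun g' hg' => ?_
  · rintro _ ⟨g, hg, rfl⟩
    exact ConjTo.map ρ hg
  · obtain ⟨g, rfl⟩ := hρ.isProjection.surjective g'
    obtain ⟨f, hf, e⟩ := hρ.exists_isMax g
    rw [← e] at hg' ⊢
    exact ⟨f, hθ.conjTo_of_map hL hρ hf hP hP hg', rfl⟩

theorem map_eq_one_iff (hθ : IsSignalizerFunctor p S θ) (hL : IsPuncturedGroup p Δ S)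
    [Fact p.Prime] {ρ : Hom L L'} (hρ : hL.IsQuotientMap (unionOf p S θ) ρ) {P : Subgrp L}
    (hP : P ∈ Δ) {g : L} (hg : g ∈ hL.normalizerSubgrp hP) :
    ρ g = one L' ↔ g ∈ onObjects p θ P := by
  rw [hθ.mem_onObjects hL hP]
  constructor
  · intro h
    have hgN := mem_union_of_map_eq_one hL hρ h
    refine ⟨hgN, fun s hs => ?_⟩
    obtain ⟨t, -, h1⟩ := (hL.mem_normalizerSubgrp hP).1 hg s hs
    exact hθ.takes_of_mem_union hL hgN h1
  · exact fun h => hρ.map_eq_one g h.1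

end IsSignalizerFunctor

end QuotientLocality

end PartialGroup

theorem theorem1p3 {p : ℕ} [Fact p.Prime] {L : Type*} [PartialGroup L]
    (Δ : Set (PartialGroup.Subgrp L)) (S : PartialGroup.Subgrp L)
    (hL : PartialGroup.IsPuncturedGroup p Δ S)
    (θ : L → Set L) (hθ : PartialGroup.IsSignalizerFunctor p S θ) :
    -- `Θ` is a signalizer functor on objects with the same union as `θ`
    (PartialGroup.IsSignalizerFunctorOnObjects p Δ (PartialGroup.onObjects p θ) ∧
      PartialGroup.unionOf p S θ = ⋃ P ∈ Δ, PartialGroup.onObjects p θ P) ∧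
    -- the union is a partial normal `p'`-subgroup
    PartialGroup.IsPartialNormalPPrime S (PartialGroup.unionOf p S θ) ∧
    -- the quotient partial group and the canonical projection
    ∃ (_ : PartialGroup (PartialGroup.MaxCosets (PartialGroup.unionOf p S θ)))
      (ρ : PartialGroup.Hom L (PartialGroup.MaxCosets (PartialGroup.unionOf p S θ))),
      PartialGroup.IsNaturalMap (PartialGroup.unionOf p S θ) ρ.toFun ∧
      ρ.IsProjection ∧
      -- `ρ` restricts to an isomorphism `e` from `S` to its image
      (∃ e : S ≃* S.map ρ, (∀ s : S, (e s : PartialGroup.MaxCosets _) = ρ (s : L)) ∧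
        -- (a) under this identification the quotient is a locality with the same objects, the
        -- same Sylow group and the same fusion system
        PartialGroup.IsLocality p (PartialGroup.Subgrp.map ρ '' Δ) (S.map ρ) ∧
        PartialGroup.FusionSystem.Identifies e (PartialGroup.fusionSystem Δ S)
          (PartialGroup.fusionSystem (PartialGroup.Subgrp.map ρ '' Δ) (S.map ρ))) ∧
      -- (b) `ρ` restricts to an epimorphism `φ : N_L(P) → N_{L/N}(P)` with kernel `Θ(P)`, which
      -- induces an isomorphism `N_L(P)/Θ(P) ≅ N_{L/N}(P)`
      ∀ P ∈ Δ, ∃ (N : PartialGroup.Subgrp L)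
        (N' : PartialGroup.Subgrp (PartialGroup.MaxCosets (PartialGroup.unionOf p S θ)))
        (φ : N →* N'),
        (N : Set L) = PartialGroup.normalizer (P : Set L) ∧
        (N' : Set (PartialGroup.MaxCosets (PartialGroup.unionOf p S θ))) =
          PartialGroup.normalizer
            (P.map ρ : Set (PartialGroup.MaxCosets (PartialGroup.unionOf p S θ))) ∧
        (∀ x : N, (φ x : PartialGroup.MaxCosets _) = ρ (x : L)) ∧
        Function.Surjective φ ∧
        (∀ x : N, x ∈ φ.ker ↔ (x : L) ∈ PartialGroup.onObjects p θ P) ∧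
        ∃ f : (N ⧸ φ.ker) ≃* N', ∀ x : N, f (x : N ⧸ φ.ker) = φ x := by
  refine ⟨⟨hθ.isSignalizerFunctorOnObjects hL, hθ.unionOf_eq hL⟩, hθ.isPartialNormalPPrime hL,
    hθ.quotient hL, hθ.proj hL, hθ.isNaturalMap hL, ?_⟩
  let := hθ.quotient hL
  have hρ := hθ.isQuotientMap_proj hL
  refine ⟨hρ.isProjection, ⟨hθ.equivMap hL hρ, fun _ => rfl, hθ.isLocality_map hL hρ,
    hθ.identifies_fusionSystem hL hρ _ fun _ => rfl⟩, fun P hP => ?_⟩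
  let N := hL.normalizerSubgrp hP
  have hsurj := N.mapHom_surjective (hθ.proj hL)
  refine ⟨N, N.map (hθ.proj hL), N.mapHom (hθ.proj hL), rfl, hθ.map_normalizer hL hρ hP,
    fun _ => rfl, hsurj, fun x => ?_,
    QuotientGroup.quotientKerEquivOfSurjective _ hsurj, fun _ => rfl⟩
  rw [← hθ.map_eq_one_iff hL hρ hP x.2, MonoidHom.mem_ker]
  exact ⟨fun h => congrArg (fun z => z.1) h, fun h => Subtype.ext h⟩
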